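/- \textbf{Setting.} Fix integers $d\ge 0$, $q\ge 1$ and a real number $r>0$. For a finite set $\Lambda$, let $\mathfrak U_\Lambda$ be the algebra of linear operators on $\bigotimes_{x\in\Lambda}\mathbb C^q$ with the operator norm $\|\cdot\|_\infty$; for finite $\Lambda\subseteq\Lambda'\subset\mathbb Z^d$, $\mathfrak U_\Lambda$ is identified with a subalgebra of $\mathfrak U_{\Lambda'}$ via $A\mapsto A\otimes\mathbb I$. Let $\mathfrak U$ be the quasi-local algebra, i.e. the completion of $\bigcup_{\Lambda\subset\mathbb Z^d\text{ finite}}\mathfrak U_\Lambda$ in this norm. For $\Gamma\subseteq\mathbb Z^d$ let $\mathfrak U_\Gamma\subseteq\mathfrak U$ be the norm closure of the union of the $\mathfrak U_X$ with $X\subseteq\Gamma$ finite, and let $\mathcal O_\Gamma$ be the set of its self-adjoint elements. For $x\in\mathbb Z^d$, $\tau_x$ is the translation automorphism of $\mathfrak U$, mapping $\mathfrak U_\Gamma$ to $\mathfrak U_{\Gamma+x}$. A \emph{state} is a positive linear functional $\rho$ on $\mathfrak U$ with $\rho(\mathbb I)=1$; it is \emph{translation invariant} if $\rho(\tau_xA)=\rho(A)$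 for all $x\in\mathbb Z^d$ and $A\in\mathfrak U$. Its marginal on a finite $\Lambda$ is the density operator $\rho_\Lambda$ with $\rho(A)=\mathrm{Tr}[\rho_\Lambda A]$ for all $A\in\mathfrak U_\Lambda$. \textbf{Distance.} For a traceless self-adjoint $\Delta\in\mathfrak U_\Lambda$ with $\Lambda$ finite, let $$\|\Delta\|_{W_1}=\tfrac12\min\Big\{\sum_{x\in\Lambda}\|\Delta^{(x)}\|_1:\ \Delta^{(x)}\in\mathfrak U_\Lambda\text{ traceless and self-adjoint},\ \mathrm{Tr}_x\Delta^{(x)}=0,\ \sum_{x\in\Lambda}\Delta^{(x)}=\Delta\Big\},$$ where $\|A\|_1=\mathrm{Tr}\sqrt{A^\dagger A}$ and $\mathrm{Tr}_x$ is the partial trace over the site $x$. For $a\in\mathbb N_+^d$ let $\Lambda_a=\{x\in\mathbb Z^d:-a_i\le x_i<a_i\ \text{for all } i\}$. The \emph{specific quantum $W_1$ distance} of translation-invariant states $\rho,\sigma$ is $$w_1(\rho,\sigma)=\lim_{a\to\infty}\frac{\|\rho_{\Lambda_a}-\sigma_{\Lambda_a}\|_{W_1}}{|\Lambda_a|},$$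 where $a\to\infty$ means that every component of $a$ tends to infinity. \textbf{Interactions.} An \emph{interaction} $\Phi$ assigns to each finite $\Lambda\subset\mathbb Z^d$ a self-adjoint $\Phi(\Lambda)\in\mathfrak U_\Lambda$. Let $\mathcal B^r$ be the set of interactions with $\Phi(\Lambda+x)=\tau_x(\Phi(\Lambda))$ for all $\Lambda$ and $x$ and $\sum_{\Lambda\ni 0}e^{r(|\Lambda|-1)}\|\Phi(\Lambda)\|_\infty<\infty$ (sums over $\Lambda\ni0$ run over the finite subsets of $\mathbb Z^d$ containing $0$). For $\Phi\in\mathcal B^r$ define the specific energy observable and the quantum Lipschitz constant by the norm-convergent series $$E_\Phi=\sum_{\Lambda\ni 0}\frac{\Phi(\Lambda)}{|\Lambda|},\qquad \|\Phi\|_L=2\inf_{A\in\mathcal O_{\mathbb Z^d\setminus\{0\}}}\Big\|\sum_{\Lambda\ni 0}\Phi(\Lambda)-A\Big\|_\infty .$$ \textbf{Theorem (Duality).} For all translation-invariant states $\rho,\sigma$, the limit defining $w_1(\rho,\sigma)$ exists and $$w_1(\rho,\sigma)=\sup\big\{\rho(E_\Phi)-\sigma(E_\Phi):\ \Phi\in\mathcal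 B^r,\ \|\Phi\|_L\le 1\big\}.$$ (It is not claimed that the supremum is attained.) -/

import Mathlib

open Filter Topology
open scoped Matrix Kronecker ComplexOrder MatrixOrder Matrix.Norms.L2Operator

noncomputable section

namespace QuantumSpin

/-! ## Finite spin systems -/

/-- Linear operators on `⨂_{x ∈ V} ℂ^q` for a finite set `V`, written as matrices in the
canonical product basis, which is indexed by the configurations `V → Fin q`.
The norm is the operator norm for the Euclidean structure. -/
abbrev Op (V : Type*) (q : ℕ) : Type _ := Matrix (V → Fin q) (V → Fin q) ℂ

section Finite

variable {V : Type*} [Fintype V] [DecidableEq V] {q : ℕ}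

/-- Partial trace over the site `x`. The equivalence `Equiv.funSplitAt x (Fin q)` splits a
configuration into its value at `x` and its restriction to the other sites. -/
def partialTrace (x : V) (A : Op V q) : Op {y : V // y ≠ x} q :=
  fun i j => ∑ s : Fin q,
    A ((Equiv.funSplitAt x (Fin q)).symm (s, i)) ((Equiv.funSplitAt x (Fin q)).symm (s, j))

/-- Trace norm `Tr √(A† A)`. -/
def traceNorm (A : Op V q) : ℝ := (CFC.sqrt (Aᴴ * A)).trace.re

/-- The quantum `W₁` norm of a traceless self-adjoint operator `Δ`: half of the minimum of
`∑ x, ‖D x‖₁` over the decompositions `Δ = ∑ x, D x` into traceless self-adjoint operators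
with `Tr_x (D x) = 0`. -/
def w1Norm (Δ : Op V q) : ℝ :=
  (1 / 2) * sInf {s : ℝ | ∃ D : V → Op V q,
    (∀ x, (D x).IsHermitian ∧ (D x).trace = 0 ∧ partialTrace x (D x) = 0) ∧
      ∑ x, D x = Δ ∧ s = ∑ x, traceNorm (D x)}

end Finite

/-! ## Local algebras on the lattice -/

/-- The lattice `ℤ^d`. -/
abbrev Site (d : ℕ) : Type := Fin d → ℤ

variable {d q : ℕ}

/-- Splitting a configuration on `Λ'` into its restrictions to `Λ` and to `Λ' \ Λ`. -/
def splitConfig {Λ Λ' : Finset (Site d)} (h : Λ ≤ Λ') :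
    (Λ' → Fin q) ≃ (Λ → Fin q) × ({y : Λ' // (y : Site d) ∉ Λ} → Fin q) where
  toFun i := (fun y => i ⟨y, h y.2⟩, fun y => i y)
  invFun p y := if hy : (y : Site d) ∈ Λ then p.1 ⟨y, hy⟩ else p.2 ⟨y, hy⟩
  left_inv i := by
    funext y
    by_cases hy : (y : Site d) ∈ Λ <;> simp [hy]
  right_inv p := by
    ext y
    · simp
    · have hy := y.2
      simp [hy]

/-- The canonical embedding `A ↦ A ⊗ 1` of the operators on `Λ` into the operators on
`Λ' ⊇ Λ`. -/
def incl {Λ Λ' : Finset (Site d)} (h : Λ ≤ Λ') : Op Λ q →⋆ₐ[ℂ] Op Λ' q where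
  toFun A := (A ⊗ₖ (1 : Op {y : Λ' // (y : Site d) ∉ Λ} q)).submatrix
    (splitConfig h) (splitConfig h)
  map_one' := by simp
  map_mul' A B := by
    rw [Matrix.submatrix_mul_equiv, ← Matrix.mul_kronecker_mul, one_mul]
  map_zero' := by simp
  map_add' A B := by rw [Matrix.add_kronecker]; rfl
  commutes' c := by
    simp only [Algebra.algebraMap_eq_smul_one, Matrix.smul_kronecker, Matrix.one_kronecker_one,
      Matrix.submatrix_smul, Pi.smul_apply, Matrix.submatrix_one_equiv]
  map_star' A := by
    simp only [Matrix.star_eq_conjTranspose, Matrix.conjTranspose_submatrix,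
      Matrix.conjTranspose_kronecker, Matrix.conjTranspose_one]

lemma incl_apply {Λ Λ' : Finset (Site d)} (h : Λ ≤ Λ') (A : Op Λ q) (i j : Λ' → Fin q) :
    incl h A i j = if ∀ y : Λ', (y : Site d) ∉ Λ → i y = j y then
      A (fun y : Λ => i ⟨y, h y.2⟩) (fun y : Λ => j ⟨y, h y.2⟩) else 0 := by
  have : (∀ y : Λ', (y : Site d) ∉ Λ → i y = j y) ↔
      ((splitConfig h i).2 = (splitConfig h j).2) := by
    simp [funext_iff, splitConfig]
  change A _ _ * (1 : Op {y : Λ' // (y : Site d) ∉ Λ} q) _ _ = _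
  rw [Matrix.one_apply]
  simp only [this]
  split_ifs <;> simp [splitConfig]

instance : DirectedSystem (fun Λ : Finset (Site d) => Op Λ q) (fun _ _ h => incl h) where
  map_self Λ A := by
    ext i j
    rw [incl_apply, if_pos]
    rintro ⟨y, hy'⟩ hy
    exact absurd hy' hy
  map_map Λ₃ Λ₂ Λ₁ h₁ h₂ A := by
    ext i j
    simp only [incl_apply]
    by_cases h : ∀ y : Λ₃, (y : Site d) ∉ Λ₁ → i y = j y
    · rw [if_pos h, if_pos (fun y hy => h y (fun hy' => hy (h₁ hy'))),
        if_pos (fun (y : Λ₂) hy => h ⟨y, h₂ y.2⟩ hy)]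
    · rw [if_neg h]
      by_cases h' : ∀ y : Λ₃, (y : Site d) ∉ Λ₂ → i y = j y
      · rw [if_pos h', if_neg]
        intro h''
        apply h
        intro y hy
        by_cases hy2 : (y : Site d) ∈ Λ₂
        · exact h'' ⟨y, hy2⟩ hy
        · exact h' y hy2
      · rw [if_neg h']

lemma incl_injective [NeZero q] {Λ Λ' : Finset (Site d)} (h : Λ ≤ Λ') :
    Function.Injective (incl h : Op Λ q →⋆ₐ[ℂ] Op Λ' q) := by
  intro A B hAB
  ext i j
  have := congrFun (congrFun hAB ((splitConfig h).symm (i, 0))) ((splitConfig h).symm (j, 0))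
  rw [incl_apply, incl_apply, if_pos, if_pos] at this
  · simpa [splitConfig] using this
  · intro y hy
    simp [splitConfig, hy]
  · intro y hy
    simp [splitConfig, hy]

lemma norm_incl [NeZero q] {Λ Λ' : Finset (Site d)} (h : Λ ≤ Λ') (A : Op Λ q) :
    ‖incl h A‖ = ‖A‖ :=
  NonUnitalStarAlgHom.norm_map _ (incl_injective h) A

/-- The strictly local algebra of the lattice: the union of the algebras of operators on the
finite regions, identified along the embeddings `A ↦ A ⊗ 1`. -/
def LocAlg (d q : ℕ) : Type :=
  DirectLimit (fun Λ : Finset (Site d) => Op Λ q) (fun _ _ h => incl h)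

instance : Ring (LocAlg d q) :=
  inferInstanceAs (Ring (DirectLimit (fun Λ : Finset (Site d) => Op Λ q) (fun _ _ h => incl h)))

instance : Algebra ℂ (LocAlg d q) :=
  inferInstanceAs
    (Algebra ℂ (DirectLimit (fun Λ : Finset (Site d) => Op Λ q) (fun _ _ h => incl h)))

instance : StarRing (LocAlg d q) :=
  inferInstanceAs
    (StarRing (DirectLimit (fun Λ : Finset (Site d) => Op Λ q) (fun _ _ h => incl h)))

instance : StarModule ℂ (LocAlg d q) :=
  inferInstanceAs
    (StarModule ℂ (DirectLimit (fun Λ : Finset (Site d) => Op Λ q) (fun _ _ h => incl h)))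

/-- The canonical embedding of the operators on `Λ` into the strictly local algebra. -/
def toLoc (Λ : Finset (Site d)) : Op Λ q →⋆ₐ[ℂ] LocAlg d q where
  toFun A := (⟦⟨Λ, A⟩⟧ : DirectLimit (fun Λ : Finset (Site d) => Op Λ q) (fun _ _ h => incl h))
  map_one' := (DirectLimit.one_def (G := fun Λ : Finset (Site d) => Op Λ q)
    (f := fun _ _ h => incl h) Λ).symm
  map_mul' A B := (DirectLimit.mul_def (G := fun Λ : Finset (Site d) => Op Λ q)
    (f := fun _ _ h => incl h) Λ A B).symm
  map_zero' := (DirectLimit.zero_def (G := fun Λ : Finset (Site d) => Op Λ q)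
    (f := fun _ _ h => incl h) Λ).symm
  map_add' A B := (DirectLimit.add_def (G := fun Λ : Finset (Site d) => Op Λ q)
    (f := fun _ _ h => incl h) Λ A B).symm
  commutes' c := (DirectLimit.map₀_algebraMap (G := fun Λ : Finset (Site d) => Op Λ q)
    (f := fun _ _ h => incl h) Λ c).symm
  map_star' A := (DirectLimit.star_def (G := fun Λ : Finset (Site d) => Op Λ q)
    (f := fun _ _ h => incl h) Λ A).symm

lemma toLoc_incl {Λ Λ' : Finset (Site d)} (h : Λ ≤ Λ') (A : Op Λ q) :
    toLoc Λ' (incl h A) = toLoc Λ A :=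
  (DirectLimit.eq_of_le (F := fun Λ : Finset (Site d) => Op Λ q)
    (f := fun _ _ h => incl h) ⟨Λ, A⟩ Λ' h).symm

lemma exists_toLoc (a : LocAlg d q) : ∃ (Λ : Finset (Site d)) (A : Op Λ q), a = toLoc Λ A :=
  DirectLimit.exists_eq_mk _ a

lemma exists_toLoc₂ (a b : LocAlg d q) :
    ∃ (Λ : Finset (Site d)) (A B : Op Λ q), a = toLoc Λ A ∧ b = toLoc Λ B :=
  DirectLimit.exists_eq_mk₂ _ a b

/-! ## Translations of local operators -/

/-- The region `Λ + x`. -/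
def translate (x : Site d) (Λ : Finset (Site d)) : Finset (Site d) :=
  Λ.map (Equiv.addRight x).toEmbedding

lemma add_mem_translate {x y : Site d} {Λ : Finset (Site d)} (h : y ∈ Λ) :
    y + x ∈ translate x Λ :=
  Finset.mem_map_of_mem (Equiv.addRight x).toEmbedding h

lemma sub_mem_of_mem_translate {x y : Site d} {Λ : Finset (Site d)} (h : y ∈ translate x Λ) :
    y - x ∈ Λ := by
  obtain ⟨z, hz, rfl⟩ := Finset.mem_map.mp h
  simpa using hz

/-- The bijection `y ↦ y + x` from `Λ` to `Λ + x`. -/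
def shiftEquiv (x : Site d) (Λ : Finset (Site d)) : Λ ≃ translate x Λ where
  toFun y := ⟨y + x, add_mem_translate y.2⟩
  invFun y := ⟨y - x, sub_mem_of_mem_translate y.2⟩
  left_inv y := by simp
  right_inv y := by simp

/-- Translation by `x` of the operators on `Λ`, which relabels each site `y` as `y + x`. -/
def opTranslate (x : Site d) (Λ : Finset (Site d)) : Op Λ q →⋆ₐ[ℂ] Op (translate x Λ) q where
  toFun A := A.submatrix ((shiftEquiv x Λ).arrowCongr (Equiv.refl (Fin q))).symm
    ((shiftEquiv x Λ).arrowCongr (Equiv.refl (Fin q))).symm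
  map_one' := by simp
  map_mul' A B := by rw [Matrix.submatrix_mul_equiv]
  map_zero' := by simp
  map_add' A B := rfl
  commutes' c := by
    simp only [Algebra.algebraMap_eq_smul_one, Matrix.submatrix_smul, Pi.smul_apply,
      Matrix.submatrix_one_equiv]
  map_star' A := rfl

lemma opTranslate_apply (x : Site d) (Λ : Finset (Site d)) (A : Op Λ q)
    (i j : translate x Λ → Fin q) :
    opTranslate x Λ A i j =
      A (fun y => i (shiftEquiv x Λ y)) (fun y => j (shiftEquiv x Λ y)) := rfl

lemma opTranslate_incl (x : Site d) {Λ Λ' : Finset (Site d)} (h : Λ ≤ Λ')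
    (h' : translate x Λ ≤ translate x Λ') (A : Op Λ q) :
    opTranslate x Λ' (incl h A) = incl h' (opTranslate x Λ A) := by
  ext i j
  rw [opTranslate_apply, incl_apply, incl_apply]
  congr 1
  apply propext
  constructor
  · intro H y hy
    have := H ((shiftEquiv x Λ').symm y) (fun hm => hy (by
      have := add_mem_translate (x := x) hm
      simpa [shiftEquiv] using this))
    simpa using this
  · intro H y hy
    exact H (shiftEquiv x Λ' y) (fun hm => hy (by
      have := sub_mem_of_mem_translate hm
      simpa [shiftEquiv] using this))

/-- Translation by `x` on the strictly local algebra. -/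
def locTranslateFun (x : Site d) : LocAlg d q → LocAlg d q :=
  DirectLimit.lift _ (fun Λ A => toLoc (translate x Λ) (opTranslate x Λ A))
    (fun Λ Λ' h A => by
      have h' : translate x Λ ≤ translate x Λ' := Finset.map_subset_map.mpr h
      rw [opTranslate_incl x h h', toLoc_incl])

lemma locTranslateFun_toLoc (x : Site d) (Λ : Finset (Site d)) (A : Op Λ q) :
    locTranslateFun x (toLoc Λ A) = toLoc (translate x Λ) (opTranslate x Λ A) := rfl

/-- Translation by `x` on the strictly local algebra, as a morphism of star algebras. -/
def locTranslate (x : Site d) : LocAlg d q →⋆ₐ[ℂ] LocAlg d q where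
  toFun := locTranslateFun x
  map_one' := by
    rw [← map_one (toLoc (∅ : Finset (Site d))), locTranslateFun_toLoc, map_one, map_one, map_one]
  map_mul' a b := by
    obtain ⟨Λ, A, B, rfl, rfl⟩ := exists_toLoc₂ a b
    rw [← map_mul, locTranslateFun_toLoc, locTranslateFun_toLoc, locTranslateFun_toLoc, map_mul,
      map_mul]
  map_zero' := by
    rw [← map_zero (toLoc (∅ : Finset (Site d))), locTranslateFun_toLoc, map_zero, map_zero,
      map_zero]
  map_add' a b := by
    obtain ⟨Λ, A, B, rfl, rfl⟩ := exists_toLoc₂ a b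
    rw [← map_add, locTranslateFun_toLoc, locTranslateFun_toLoc, locTranslateFun_toLoc, map_add,
      map_add]
  commutes' c := by
    rw [← AlgHomClass.commutes (toLoc (∅ : Finset (Site d))) c, locTranslateFun_toLoc,
      AlgHomClass.commutes, AlgHomClass.commutes, AlgHomClass.commutes]
  map_star' a := by
    obtain ⟨Λ, A, rfl⟩ := exists_toLoc a
    rw [← map_star, locTranslateFun_toLoc, locTranslateFun_toLoc, map_star, map_star]

lemma opTranslate_injective (x : Site d) (Λ : Finset (Site d)) :
    Function.Injective (opTranslate x Λ : Op Λ q →⋆ₐ[ℂ] Op (translate x Λ) q) := by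
  intro A B h
  ext i j
  have := congrFun (congrFun h (fun y => i ((shiftEquiv x Λ).symm y)))
    (fun y => j ((shiftEquiv x Λ).symm y))
  simpa [opTranslate_apply] using this

/-! ## The quasi-local algebra -/

section QuasiLocal

variable [NeZero q]

/-- The norm of the strictly local algebra, inherited from the operator norms. -/
def locNorm : RingNorm (LocAlg d q) where
  toFun := DirectLimit.lift _ (fun _ A => ‖A‖) (fun _ _ h A => (norm_incl h A).symm)
  map_zero' := by
    rw [← map_zero (toLoc (∅ : Finset (Site d)))]
    exact norm_zero
  add_le' a b := by
    obtain ⟨Λ, A, B, rfl, rfl⟩ := exists_toLoc₂ a b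
    rw [← map_add]
    exact norm_add_le A B
  neg' a := by
    obtain ⟨Λ, A, rfl⟩ := exists_toLoc a
    rw [← map_neg]
    exact norm_neg A
  mul_le' a b := by
    obtain ⟨Λ, A, B, rfl, rfl⟩ := exists_toLoc₂ a b
    rw [← map_mul]
    exact norm_mul_le A B
  eq_zero_of_map_eq_zero' a := by
    obtain ⟨Λ, A, rfl⟩ := exists_toLoc a
    intro h
    have : A = 0 := norm_eq_zero.mp h
    rw [this, map_zero]

instance : NormedRing (LocAlg d q) := RingNorm.toNormedRing locNorm

lemma norm_toLoc (Λ : Finset (Site d)) (A : Op Λ q) : ‖toLoc Λ A‖ = ‖A‖ := rfl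

instance : NormedAlgebra ℂ (LocAlg d q) where
  norm_smul_le c a := by
    obtain ⟨Λ, A, rfl⟩ := exists_toLoc a
    rw [← map_smul, norm_toLoc, norm_toLoc]
    exact norm_smul_le c A

instance : CStarRing (LocAlg d q) where
  norm_mul_self_le a := by
    obtain ⟨Λ, A, rfl⟩ := exists_toLoc a
    rw [← map_star, ← map_mul, norm_toLoc, norm_toLoc]
    exact CStarRing.norm_mul_self_le A

/-- The quasi-local algebra: the completion of the strictly local algebra. -/
def QuasiLocal (d q : ℕ) [NeZero q] : Type := UniformSpace.Completion (LocAlg d q)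

instance : NormedRing (QuasiLocal d q) :=
  inferInstanceAs (NormedRing (UniformSpace.Completion (LocAlg d q)))

instance : CompleteSpace (QuasiLocal d q) :=
  inferInstanceAs (CompleteSpace (UniformSpace.Completion (LocAlg d q)))

instance : Algebra ℂ (QuasiLocal d q) :=
  inferInstanceAs (Algebra ℂ (UniformSpace.Completion (LocAlg d q)))

/-- The inclusion of the strictly local algebra into the quasi-local algebra. -/
def ofLoc : LocAlg d q →ₐ[ℂ] QuasiLocal d q where
  __ := (UniformSpace.Completion.coeRingHom : LocAlg d q →+* UniformSpace.Completion (LocAlg d q))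
  commutes' _ := rfl

lemma norm_ofLoc (a : LocAlg d q) : ‖ofLoc a‖ = ‖a‖ := UniformSpace.Completion.norm_coe a

lemma isometry_ofLoc : Isometry (ofLoc : LocAlg d q → QuasiLocal d q) :=
  AddMonoidHomClass.isometry_of_norm ofLoc norm_ofLoc

lemma denseRange_ofLoc : DenseRange (ofLoc : LocAlg d q → QuasiLocal d q) :=
  UniformSpace.Completion.denseRange_coe

instance : NormedAlgebra ℂ (QuasiLocal d q) where
  norm_smul_le c a :=
    norm_smul_le (α := ℂ) (β := UniformSpace.Completion (LocAlg d q)) c a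

/-- The adjoint on the quasi-local algebra is the continuous extension of the adjoint on the
strictly local algebra. -/
instance : Star (QuasiLocal d q) where
  star := UniformSpace.Completion.map (star : LocAlg d q → LocAlg d q)

lemma continuous_star_quasiLocal : Continuous (star : QuasiLocal d q → QuasiLocal d q) :=
  UniformSpace.Completion.continuous_map

lemma star_ofLoc (a : LocAlg d q) : star (ofLoc a) = ofLoc (star a) :=
  UniformSpace.Completion.map_coe star_isometry.uniformContinuous a

instance : StarRing (QuasiLocal d q) where
  star_involutive := by
    have hc := continuous_star_quasiLocal (d := d) (q := q)
    refine fun a => denseRange_ofLoc.induction_on a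
      (isClosed_eq (hc.comp hc) continuous_id) fun b => ?_
    rw [star_ofLoc, star_ofLoc, star_star]
  star_mul := by
    have hc := continuous_star_quasiLocal (d := d) (q := q)
    refine fun a b => denseRange_ofLoc.induction_on₂ (p := fun a b : QuasiLocal d q =>
      star (a * b) = star b * star a) (isClosed_eq (hc.comp continuous_mul)
        ((hc.comp continuous_snd).mul (hc.comp continuous_fst))) (fun a b => ?_) a b
    rw [← map_mul, star_ofLoc, star_ofLoc, star_ofLoc, star_mul, map_mul]
  star_add := by
    have hc := continuous_star_quasiLocal (d := d) (q := q)
    refine fun a b => denseRange_ofLoc.induction_on₂ (p := fun a b : QuasiLocal d q =>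
      star (a + b) = star a + star b) (isClosed_eq (hc.comp continuous_add)
        ((hc.comp continuous_fst).add (hc.comp continuous_snd))) (fun a b => ?_) a b
    rw [← map_add, star_ofLoc, star_ofLoc, star_ofLoc, star_add, map_add]

/-- The quasi-local algebra is a C*-algebra. -/
instance : CStarAlgebra (QuasiLocal d q) where
  norm_mul_self_le a := by
    have hc := continuous_star_quasiLocal (d := d) (q := q)
    refine denseRange_ofLoc.induction_on (p := fun a : QuasiLocal d q =>
      ‖a‖ * ‖a‖ ≤ ‖star a * a‖) a (isClosed_le (continuous_norm.mul continuous_norm)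
        (hc.mul continuous_id).norm) fun a => ?_
    rw [star_ofLoc, ← map_mul, norm_ofLoc, norm_ofLoc]
    exact CStarRing.norm_mul_self_le a
  star_smul c a := by
    have hc := continuous_star_quasiLocal (d := d) (q := q)
    refine denseRange_ofLoc.induction_on (p := fun a : QuasiLocal d q =>
      star (c • a) = star c • star a) a (isClosed_eq (hc.comp (continuous_const_smul c))
        (hc.const_smul (star c))) fun a => ?_
    rw [← map_smul, star_ofLoc, star_ofLoc, star_smul, map_smul]

/-- The canonical embedding of the operators on the finite region `Λ` into the quasi-local
algebra. -/
def emb (Λ : Finset (Site d)) : Op Λ q →⋆ₐ[ℂ] QuasiLocal d q where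
  __ := (ofLoc (d := d) (q := q)).comp (toLoc Λ).toAlgHom
  map_star' A := by
    change ofLoc (toLoc Λ (star A)) = star (ofLoc (toLoc Λ A))
    rw [map_star, star_ofLoc]

lemma norm_emb (Λ : Finset (Site d)) (A : Op Λ q) : ‖emb Λ A‖ = ‖A‖ := norm_ofLoc (toLoc Λ A)

lemma emb_incl {Λ Λ' : Finset (Site d)} (h : Λ ≤ Λ') (A : Op Λ q) :
    emb Λ' (incl h A) = emb Λ A :=
  congrArg ofLoc (toLoc_incl h A)

/-- The algebra of a (not necessarily finite) region `Γ`: the norm closure of the union of the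
algebras of the finite regions contained in `Γ`. -/
def regionAlg (Γ : Set (Site d)) : Set (QuasiLocal d q) :=
  closure {a | ∃ (X : Finset (Site d)) (A : Op X q), (X : Set (Site d)) ⊆ Γ ∧ a = emb X A}

/-- The self-adjoint elements of the algebra of the region `Γ`. -/
def observables (Γ : Set (Site d)) : Set (QuasiLocal d q) :=
  {a | a ∈ regionAlg Γ ∧ IsSelfAdjoint a}

lemma norm_locTranslate (x : Site d) (a : LocAlg d q) : ‖locTranslate x a‖ = ‖a‖ := by
  obtain ⟨Λ, A, rfl⟩ := exists_toLoc a
  change ‖toLoc (translate x Λ) (opTranslate x Λ A)‖ = _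
  rw [norm_toLoc, norm_toLoc]
  exact NonUnitalStarAlgHom.norm_map _ (opTranslate_injective x Λ) A

lemma isometry_locTranslate (x : Site d) :
    Isometry (locTranslate x : LocAlg d q → LocAlg d q) :=
  AddMonoidHomClass.isometry_of_norm (locTranslate x) (norm_locTranslate x)

/-- Translation by `x` on the quasi-local algebra: the continuous extension of the translation of
the strictly local algebra. -/
def translationFun (x : Site d) : QuasiLocal d q → QuasiLocal d q :=
  UniformSpace.Completion.map (locTranslate x)

lemma continuous_translationFun (x : Site d) :
    Continuous (translationFun x : QuasiLocal d q → QuasiLocal d q) :=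
  UniformSpace.Completion.continuous_map

lemma translationFun_ofLoc (x : Site d) (a : LocAlg d q) :
    translationFun x (ofLoc a) = ofLoc (locTranslate x a) :=
  UniformSpace.Completion.map_coe (isometry_locTranslate x).uniformContinuous a

/-- The translation `τ_x` of the quasi-local algebra, as a morphism of star algebras. -/
def translation (x : Site d) : QuasiLocal d q →⋆ₐ[ℂ] QuasiLocal d q where
  toFun := translationFun x
  map_one' := by
    rw [← map_one (ofLoc (d := d) (q := q)), translationFun_ofLoc, map_one]
  map_mul' := by
    have ht := continuous_translationFun (q := q) x
    refine fun a b => denseRange_ofLoc.induction_on₂ (p := fun a b : QuasiLocal d q =>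
      translationFun x (a * b) = translationFun x a * translationFun x b)
      (isClosed_eq (ht.comp continuous_mul)
        ((ht.comp continuous_fst).mul (ht.comp continuous_snd))) (fun a b => ?_) a b
    rw [← map_mul, translationFun_ofLoc, translationFun_ofLoc, translationFun_ofLoc, map_mul,
      map_mul]
  map_zero' := by
    rw [← map_zero (ofLoc (d := d) (q := q)), translationFun_ofLoc, map_zero]
  map_add' := by
    have ht := continuous_translationFun (q := q) x
    refine fun a b => denseRange_ofLoc.induction_on₂ (p := fun a b : QuasiLocal d q =>
      translationFun x (a + b) = translationFun x a + translationFun x b)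
      (isClosed_eq (ht.comp continuous_add)
        ((ht.comp continuous_fst).add (ht.comp continuous_snd))) (fun a b => ?_) a b
    rw [← map_add, translationFun_ofLoc, translationFun_ofLoc, translationFun_ofLoc, map_add,
      map_add]
  commutes' c := by
    rw [← AlgHomClass.commutes (ofLoc (d := d) (q := q)) c, translationFun_ofLoc,
      AlgHomClass.commutes]
  map_star' a := by
    have hc := continuous_star_quasiLocal (d := d) (q := q)
    have ht := continuous_translationFun (q := q) x
    refine denseRange_ofLoc.induction_on a (isClosed_eq (ht.comp hc) (hc.comp ht)) fun b => ?_
    rw [star_ofLoc, translationFun_ofLoc, translationFun_ofLoc, star_ofLoc, map_star]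

lemma translation_emb (x : Site d) (Λ : Finset (Site d)) (A : Op Λ q) :
    translation x (emb Λ A) = emb (translate x Λ) (opTranslate x Λ A) :=
  translationFun_ofLoc x (toLoc Λ A)

/-! ## States -/

/-- A quantum state of the lattice: a positive linear functional on the quasi-local algebra with
value `1` at the identity. -/
structure State (d q : ℕ) [NeZero q] where
  /-- The expectation value of the elements of the quasi-local algebra. -/
  expect : QuasiLocal d q →ₗ[ℂ] ℂ
  nonneg : ∀ a, 0 ≤ expect (star a * a)
  map_one : expect 1 = 1

/-- The state is invariant under all the translations. -/
def State.IsTranslationInvariant (ρ : State d q) : Prop :=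
  ∀ (x : Site d) (a : QuasiLocal d q), ρ.expect (translation x a) = ρ.expect a

/-- The marginal state on the finite region `Λ`, written as a density matrix. -/
def State.marginal (ρ : State d q) (Λ : Finset (Site d)) : Op Λ q :=
  fun i j => ρ.expect (emb Λ (Matrix.single j i 1))

/-- The marginal state is the restriction of the state: `ρ(A) = Tr[ρ_Λ A]`. -/
lemma State.expect_emb (ρ : State d q) (Λ : Finset (Site d)) (A : Op Λ q) :
    ρ.expect (emb Λ A) = (ρ.marginal Λ * A).trace := by
  conv_lhs => rw [Matrix.matrix_eq_sum_single A]
  simp only [map_sum, Matrix.trace, Matrix.diag, Matrix.mul_apply]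
  rw [Finset.sum_comm]
  refine Finset.sum_congr rfl fun i _ => Finset.sum_congr rfl fun j _ => ?_
  have : Matrix.single j i (A j i) = A j i • Matrix.single j i (1 : ℂ) := by
    rw [Matrix.smul_single, smul_eq_mul, mul_one]
  rw [this, map_smul, map_smul, smul_eq_mul, mul_comm]
  rfl

/-- The box `{x : -a ≤ x < a}`, with the inequalities holding for each component. -/
def box (a : Fin d → ℕ+) : Finset (Site d) :=
  Fintype.piFinset fun i => Finset.Ico (-((a i : ℕ) : ℤ)) ((a i : ℕ) : ℤ)

/-- The quantum `W₁` distance per site between the marginal states on the box. -/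
def w1PerSite (ρ σ : State d q) (a : Fin d → ℕ+) : ℝ :=
  w1Norm (ρ.marginal (box a) - σ.marginal (box a)) / (box a).card

/-- The specific quantum `W₁` distance: the limit of the quantum `W₁` distance per site as all the
components of `a` tend to infinity. -/
def specificW1 (ρ σ : State d q) : ℝ :=
  limUnder (atTop : Filter (Fin d → ℕ+)) (w1PerSite ρ σ)

/-! ## Interactions -/

/-- An interaction: a self-adjoint operator on each finite region. -/
structure Interaction (d q : ℕ) where
  /-- The interaction term of each finite region. -/
  term : (Λ : Finset (Site d)) → Op Λ q
  isHermitian : ∀ Λ, (term Λ).IsHermitian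

/-- Translation invariance: `Φ(Λ + x) = τ_x (Φ(Λ))`. -/
def Interaction.IsTranslationInvariant (Φ : Interaction d q) : Prop :=
  ∀ (x : Site d) (Λ : Finset (Site d)),
    emb (translate x Λ) (Φ.term (translate x Λ)) = translation x (emb Λ (Φ.term Λ))

/-- The set `B^r` of the translation-invariant interactions with
`∑_{Λ ∋ 0} e^{r (|Λ| - 1)} ‖Φ(Λ)‖ < ∞`. -/
def interactionSpace (d q : ℕ) [NeZero q] (r : ℝ) : Set (Interaction d q) :=
  {Φ | Φ.IsTranslationInvariant ∧
    Summable fun Λ : {Λ : Finset (Site d) // 0 ∈ Λ} =>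
      Real.exp (r * ((Λ.1.card : ℝ) - 1)) * ‖Φ.term Λ.1‖}

/-- The specific energy observable `∑_{Λ ∋ 0} Φ(Λ) / |Λ|`. -/
def Interaction.specificEnergy (Φ : Interaction d q) : QuasiLocal d q :=
  ∑' Λ : {Λ : Finset (Site d) // 0 ∈ Λ}, (Λ.1.card : ℂ)⁻¹ • emb Λ.1 (Φ.term Λ.1)

/-- The dependence of `H` on the site `x`: twice the infimum of `‖H - A‖` over the observables
`A` of `ℤ^d \ x`. -/
def dependence (x : Site d) (H : QuasiLocal d q) : ℝ :=
  2 * ⨅ A : observables (q := q) ({x}ᶜ : Set (Site d)), ‖H - A‖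

/-- The quantum Lipschitz constant: the dependence of `∑_{Λ ∋ 0} Φ(Λ)` on the site `0`. -/
def Interaction.lipschitzConst (Φ : Interaction d q) : ℝ :=
  dependence 0 (∑' Λ : {Λ : Finset (Site d) // 0 ∈ Λ}, emb Λ.1 (Φ.term Λ.1))

end QuasiLocal

end QuantumSpin

end

set_option linter.unusedSectionVars false

noncomputable section

namespace QuantumSpin

/-! ## The trace norm -/

section TraceNorm

variable {V : Type*} [Fintype V] [DecidableEq V] {q : ℕ}

/-! Convergence needs no subadditivity argument. In every box the `W₁` distance per site is itself
one of the values in the supremum, and every such value is asymptotically a lower bound for it.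
Together these force the limit to exist and to be the supremum.

First half. On a finite region the `W₁` norm is the quotient norm of `½ ∑ ‖D x‖₁`, on families with
`Tr_x (D x) = 0`, under `D ↦ ∑ D x`. Hahn–Banach yields a functional `A ↦ Re Tr[H A]` that attains
it, and the bound on each component of the functional says that `H` is within `1/2` of an operator
not acting on `x` (`exists_observable_eq_w1Norm`). Take `H` optimal for the marginals on `Λ` and the
interaction that puts `τ_x(H) / |Λ|` on `Λ + x`. Its terms containing `0` sum to the average over `x
∈ Λ` of `τ_{-x}(H)`; each of these is within `1/2` of an operator off `0`, so the Lipschitz constant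
is at most `1`. Its energy difference is exactly the `W₁` norm per site
(`w1Norm_div_card_mem_dualValues`).

Second half. The energy of `Φ` in a box should serve as test observable, but a sharp restriction to
the box fails: near the boundary only part of `∑_{X ∋ x} Φ(X)` survives, and the Lipschitz constant,
which sees the full sum with its cancellations, does not control a part. A single bad site spoils
the estimate, because the duality bound uses the largest dependence. Instead only regions of
diameter at most `R` are kept, and `Φ(X)` is weighted by the average over `X` of a cutoff `f` that
falls linearly from `1` to `0` over a distance `N`. The terms that contain `x` then sum to `f x`
times the translated full sum, up to an error of order `R / N` (`exists_norm_cutoffEnergy_sub_le`),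
while the expectation is `∑ f` times that of the truncated specific energy
(`expectDiff_cutoffEnergy`). As the box grows, `∑ f` divided by its volume tends to `1`, and the
easy half of finite duality (`re_trace_mul_le_w1Norm`) gives `eventually_sub_le_w1PerSite`. -/

lemma trace_mul_re_nonneg {A B : Op V q} (hA : A.PosSemidef) (hB : B.PosSemidef) :
    0 ≤ (A * B).trace.re := by
  obtain ⟨C, rfl⟩ := CStarAlgebra.nonneg_iff_eq_star_mul_self.mp
    (Matrix.nonneg_iff_posSemidef.mpr hB)
  rw [← mul_assoc, Matrix.trace_mul_comm, ← mul_assoc]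
  exact (Complex.nonneg_iff.mp (hA.mul_mul_conjTranspose_same C).trace_nonneg).1

lemma traceNorm_eq_posPart_add_negPart {D : Op V q} (hD : D.IsHermitian) :
    traceNorm D = (D⁺).trace.re + (D⁻).trace.re := by
  have hD' : IsSelfAdjoint D := hD
  have h : CFC.abs D = D⁺ + D⁻ := (CFC.posPart_add_negPart D).symm
  change (CFC.abs D).trace.re = _
  rw [h, Matrix.trace_add, Complex.add_re]

lemma traceNorm_nonneg (D : Op V q) : 0 ≤ traceNorm D :=
  (Complex.nonneg_iff.mp (Matrix.nonneg_iff_posSemidef.mp (CFC.abs_nonneg D)).trace_nonneg).1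

lemma traceNorm_of_posSemidef {P : Op V q} (hP : P.PosSemidef) : traceNorm P = P.trace.re := by
  change (CFC.abs P).trace.re = _
  rw [CFC.abs_of_nonneg P (Matrix.nonneg_iff_posSemidef.mpr hP)]

lemma traceNorm_neg (D : Op V q) : traceNorm (-D) = traceNorm D := by
  change (CFC.abs (-D)).trace.re = _
  rw [CFC.abs_neg]; rfl

lemma traceNorm_smul {c : ℝ} (hc : 0 ≤ c) (D : Op V q) : traceNorm (c • D) = c * traceNorm D := by
  change (CFC.abs (c • D)).trace.re = c * (CFC.abs D).trace.re
  rw [CFC.abs_smul, Matrix.trace_smul, Complex.smul_re, Real.norm_of_nonneg hc, smul_eq_mul]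

lemma traceNorm_zero : traceNorm (0 : Op V q) = 0 := by
  simpa using traceNorm_smul le_rfl (0 : Op V q)

/-- The self-adjoint part of an operator. -/
def herm : Op V q →ₗ[ℝ] Op V q where
  toFun A := (2⁻¹ : ℝ) • (A + Aᴴ)
  map_add' A B := by rw [Matrix.conjTranspose_add, ← smul_add]; congr 1; abel
  map_smul' c A := by
    rw [Matrix.conjTranspose_smul, star_trivial, ← smul_add, smul_comm]; rfl

lemma herm_apply (A : Op V q) : herm A = (2⁻¹ : ℝ) • (A + Aᴴ) := rfl

lemma isHermitian_herm (A : Op V q) : (herm A).IsHermitian := by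
  rw [herm_apply, Matrix.IsHermitian, Matrix.conjTranspose_smul, star_trivial,
    Matrix.conjTranspose_add, Matrix.conjTranspose_conjTranspose, add_comm]

lemma herm_of_isHermitian {A : Op V q} (hA : A.IsHermitian) : herm A = A := by
  rw [herm_apply, hA.eq, ← two_smul ℝ A, smul_smul]; norm_num

lemma norm_herm_le (A : Op V q) : ‖herm A‖ ≤ ‖A‖ := by
  rw [herm_apply, norm_smul]
  have h1 := norm_add_le A Aᴴ
  have h2 : ‖Aᴴ‖ = ‖A‖ := norm_star A
  norm_num
  linarith

lemma re_trace_herm_mul (G : Op V q) {D : Op V q} (hD : D.IsHermitian) :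
    (herm G * D).trace.re = (G * D).trace.re := by
  have h : (Gᴴ * D).trace = star (G * D).trace := by
    rw [← Matrix.trace_conjTranspose, Matrix.conjTranspose_mul, hD.eq, Matrix.trace_mul_comm]
  rw [herm_apply, Matrix.smul_mul, Matrix.trace_smul, Complex.smul_re, add_mul, Matrix.trace_add,
    Complex.add_re, h]
  simp
  ring

/-- The positive operators `‖G‖ - G` and `‖G‖ + G` are paired with `D⁺` and `D⁻` respectively; the
trace of a product of two positive operators is nonnegative. -/
lemma re_trace_mul_le_of_isHermitian {G D : Op V q} (hG : G.IsHermitian) (hD : D.IsHermitian) :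
    (G * D).trace.re ≤ ‖G‖ * traceNorm D := by
  have hD' : IsSelfAdjoint D := hD
  have hG' : IsSelfAdjoint G := hG
  have h1 : (algebraMap ℝ (Op V q) ‖G‖ - G).PosSemidef := hG'.le_algebraMap_norm_self
  have h2 : (G + algebraMap ℝ (Op V q) ‖G‖).PosSemidef := by
    have := hG'.neg_algebraMap_norm_le_self
    rw [Matrix.le_iff, sub_neg_eq_add] at this
    exact this
  have p1 : (D⁺).PosSemidef := Matrix.nonneg_iff_posSemidef.mp (CFC.posPart_nonneg D)
  have p2 : (D⁻).PosSemidef := Matrix.nonneg_iff_posSemidef.mp (CFC.negPart_nonneg D)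
  have e1 := trace_mul_re_nonneg h1 p1
  have e2 := trace_mul_re_nonneg h2 p2
  rw [sub_mul, Matrix.trace_sub, Complex.sub_re, Algebra.algebraMap_eq_smul_one, smul_mul_assoc,
    one_mul, Matrix.trace_smul, Complex.smul_re, smul_eq_mul] at e1
  rw [add_mul, Matrix.trace_add, Complex.add_re, Algebra.algebraMap_eq_smul_one, smul_mul_assoc,
    one_mul, Matrix.trace_smul, Complex.smul_re, smul_eq_mul] at e2
  have e3 : (G * D).trace.re = (G * D⁺).trace.re - (G * D⁻).trace.re := by
    conv_lhs => rw [← CFC.posPart_sub_negPart D]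
    rw [mul_sub, Matrix.trace_sub, Complex.sub_re]
  rw [traceNorm_eq_posPart_add_negPart hD, e3]
  linarith

/-- The duality inequality between the trace norm and the operator norm. -/
lemma re_trace_mul_le (G : Op V q) {D : Op V q} (hD : D.IsHermitian) :
    (G * D).trace.re ≤ ‖G‖ * traceNorm D := by
  rw [← re_trace_herm_mul G hD]
  exact (re_trace_mul_le_of_isHermitian (isHermitian_herm G) hD).trans
    (mul_le_mul_of_nonneg_right (norm_herm_le G) (traceNorm_nonneg D))

lemma exists_norm_le_one_trace_mul_eq {D : Op V q} (hD : D.IsHermitian) :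
    ∃ S : Op V q, ‖S‖ ≤ 1 ∧ (S * D).trace.re = traceNorm D := by
  have hD' : IsSelfAdjoint D := hD
  let f : ℝ → ℝ := fun x => SignType.sign x
  -- The sign function jumps at `0`, but every function is continuous on a finite spectrum.
  have hc : ContinuousOn f (spectrum ℝ D) := (Matrix.finite_real_spectrum (A := D)).continuousOn f
  refine ⟨cfc f D, norm_cfc_le zero_le_one fun x _ => ?_, ?_⟩
  · rcases lt_trichotomy x 0 with h | h | h <;> simp [f, h]
  · have : cfc f D * D = CFC.abs D := by
      rw [CFC.abs_eq_cfc_norm D, show cfc f D * D = cfc f D * cfc (fun x : ℝ => x) D by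
        rw [cfc_id' ℝ D], ← cfc_mul f (fun x => x) D hc]
      refine cfc_congr fun x _ => ?_
      simp [f, sign_mul_self]
    rw [this]; rfl

/-- The trace norm of a Hermitian operator is the maximum of `Re Tr[S D]` over contractions `S`,
hence subadditive. -/
lemma traceNorm_add_le {A B : Op V q} (hA : A.IsHermitian) (hB : B.IsHermitian) :
    traceNorm (A + B) ≤ traceNorm A + traceNorm B := by
  obtain ⟨S, hS, h⟩ := exists_norm_le_one_trace_mul_eq (hA.add hB)
  rw [← h, mul_add, Matrix.trace_add, Complex.add_re]
  have h1 := re_trace_mul_le S hA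
  have h2 := re_trace_mul_le S hB
  have h3 := mul_le_mul_of_nonneg_right hS (traceNorm_nonneg A)
  have h4 := mul_le_mul_of_nonneg_right hS (traceNorm_nonneg B)
  linarith

lemma traceNorm_sub_le {A B : Op V q} (hA : A.IsHermitian) (hB : B.IsHermitian) :
    traceNorm (A - B) ≤ traceNorm A + traceNorm B := by
  rw [sub_eq_add_neg, ← traceNorm_neg B]
  exact traceNorm_add_le hA hB.neg

/-- Testing on `± |x⟩⟨x|` gives `-c ≤ G ≤ c` as operators, which confines the spectrum of `G` to
`[-c, c]`. -/
lemma norm_le_of_re_trace_mul_le {G : Op V q} (hG : G.IsHermitian) {c : ℝ} (hc : 0 ≤ c)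
    (h : ∀ D : Op V q, D.IsHermitian → (G * D).trace.re ≤ c * traceNorm D) : ‖G‖ ≤ c := by
  have key : ∀ G : Op V q, G.IsHermitian →
      (∀ P : Op V q, P.PosSemidef → (G * P).trace.re ≤ c * P.trace.re) →
      G ≤ algebraMap ℝ (Op V q) c := by
    intro G hG h
    have hH : (algebraMap ℝ (Op V q) c - G).IsHermitian :=
      (IsSelfAdjoint.algebraMap (Op V q) (star_trivial c)).sub hG
    refine Matrix.le_iff.mpr (Matrix.PosSemidef.of_dotProduct_mulVec_nonneg hH fun x => ?_)
    have hP := Matrix.posSemidef_vecMulVec_self_star x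
    have e : star x ⬝ᵥ ((algebraMap ℝ (Op V q) c - G) *ᵥ x) =
        ((algebraMap ℝ (Op V q) c - G) * Matrix.vecMulVec x (star x)).trace := by
      rw [Matrix.mul_vecMulVec, Matrix.trace_vecMulVec, dotProduct_comm]
    have him : (star x ⬝ᵥ ((algebraMap ℝ (Op V q) c - G) *ᵥ x)).im = 0 :=
      hH.im_star_dotProduct_mulVec_self x
    refine Complex.nonneg_iff.mpr ⟨?_, him.symm⟩
    rw [e, sub_mul, Matrix.trace_sub, Complex.sub_re, Algebra.algebraMap_eq_smul_one,
      smul_mul_assoc, one_mul, Matrix.trace_smul, Complex.smul_re, smul_eq_mul]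
    linarith [h _ hP]
  have h1 := key G hG fun P hP => by
    rw [← traceNorm_of_posSemidef hP]; exact h P hP.isHermitian
  have h2 := key (-G) hG.neg fun P hP => by
    have := h (-P) hP.isHermitian.neg
    rw [traceNorm_neg, traceNorm_of_posSemidef hP, mul_neg, ← neg_mul] at this
    exact this
  have hG' : IsSelfAdjoint G := hG
  rw [← cfc_id' ℝ G]
  refine norm_cfc_le hc fun x hx => ?_
  rw [Real.norm_eq_abs, abs_le]
  rw [le_algebraMap_iff_spectrum_le] at h1
  rw [neg_le, ← map_neg, algebraMap_le_iff_le_spectrum] at h2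
  exact ⟨h2 x hx, h1 x hx⟩

end TraceNorm

/-! ## Operators that do not act on a site -/

section SiteAverage

variable {V : Type*} [Fintype V] [DecidableEq V] {q : ℕ}

open Function (update)

lemma funSplitAt_symm_eq_update (x : V) (s t : Fin q) (i : {y : V // y ≠ x} → Fin q) :
    (Equiv.funSplitAt x (Fin q)).symm (s, i) =
      update ((Equiv.funSplitAt x (Fin q)).symm (t, i)) x s := by
  funext y
  by_cases hy : y = x
  · subst hy; simp
  · simp [hy]

lemma funSplitAt_symm_update (x : V) (s : Fin q) (i : V → Fin q) :
    (Equiv.funSplitAt x (Fin q)).symm (s, fun y => i y) = update i x s := by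
  funext y
  by_cases hy : y = x
  · subst hy; simp
  · simp [hy]

lemma sum_funSplitAt {M : Type*} [AddCommMonoid M] (x : V) (f : (V → Fin q) → M) :
    ∑ i, f i = ∑ s, ∑ i, f ((Equiv.funSplitAt x (Fin q)).symm (s, i)) := by
  rw [← Fintype.sum_prod_type', Equiv.sum_comp (Equiv.funSplitAt x (Fin q)).symm f]

lemma partialTrace_eq_zero_iff (x : V) (A : Op V q) :
    partialTrace x A = 0 ↔ ∀ i j, ∑ s, A (update i x s) (update j x s) = 0 := by
  constructor
  · intro h i j
    have := congrFun (congrFun h fun y => i y) fun y => j y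
    simp only [partialTrace, funSplitAt_symm_update] at this
    exact this
  · intro h
    ext i j
    obtain _ | ⟨⟨t⟩⟩ := isEmpty_or_nonempty (Fin q)
    · simp [partialTrace]
    · have := h ((Equiv.funSplitAt x (Fin q)).symm (t, i)) ((Equiv.funSplitAt x (Fin q)).symm (t, j))
      simp only [← funSplitAt_symm_eq_update x] at this
      exact this

/-- The operator `A` has the form `1_x ⊗ B`: it acts trivially on the site `x`. -/
def ActsOff (x : V) (A : Op V q) : Prop :=
  ∀ i j, (i x ≠ j x → A i j = 0) ∧ ∀ s, i x = j x → A (update i x s) (update j x s) = A i j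

/-- With `A = 1_x ⊗ B` the trace equals `Tr[B Tr_x D]`. The proof computes this in coordinates, with
`t` as reference value at `x` for reading off `B`. -/
lemma ActsOff.trace_mul_eq_zero {x : V} {A D : Op V q} (hA : ActsOff x A)
    (hD : partialTrace x D = 0) : (A * D).trace = 0 := by
  obtain _ | ⟨⟨t⟩⟩ := isEmpty_or_nonempty (Fin q)
  · have : IsEmpty (V → Fin q) := ⟨fun i => isEmptyElim (i x)⟩
    simp [Matrix.trace]
  let e := (Equiv.funSplitAt x (Fin q)).symm
  have h : ∀ s s' i j, A (e (s, i)) (e (s', j)) =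
      if s = s' then A (e (t, i)) (e (t, j)) else 0 := by
    intro s s' i j
    split_ifs with hs
    · subst hs
      have := (hA (e (t, i)) (e (t, j))).2 s (by simp [e])
      rw [← this]
      simp only [e]
      rw [← funSplitAt_symm_eq_update x s t i, ← funSplitAt_symm_eq_update x s t j]
    · exact (hA _ _).1 (by simpa [e] using hs)
  simp only [Matrix.trace, Matrix.diag, Matrix.mul_apply]
  rw [sum_funSplitAt x]
  simp_rw [sum_funSplitAt x (fun j => A _ j * _)]
  change ∑ s, ∑ i, ∑ s', ∑ j, A (e (s, i)) (e (s', j)) * D (e (s', j)) (e (s, i)) = 0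
  have h' : ∀ s i, (∑ s', ∑ j, A (e (s, i)) (e (s', j)) * D (e (s', j)) (e (s, i))) =
      ∑ j, A (e (t, i)) (e (t, j)) * D (e (s, j)) (e (s, i)) := by
    intro s i
    rw [Finset.sum_eq_single s]
    · exact Finset.sum_congr rfl fun j _ => by rw [h, if_pos rfl]
    · intro s' _ hs
      exact Finset.sum_eq_zero fun j _ => by rw [h, if_neg hs.symm, zero_mul]
    · simp
  rw [Finset.sum_congr rfl fun s _ => Finset.sum_congr rfl fun i _ => h' s i]
  rw [Finset.sum_comm]
  refine Finset.sum_eq_zero fun i _ => ?_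
  rw [Finset.sum_comm]
  refine Finset.sum_eq_zero fun j _ => ?_
  rw [← Finset.mul_sum]
  have := congrFun (congrFun hD j) i
  change ∑ s, D (e (s, j)) (e (s, i)) = 0 at this
  rw [this, mul_zero]

lemma ActsOff.herm {x : V} {A : Op V q} (hA : ActsOff x A) : ActsOff x (herm A) := by
  intro i j
  refine ⟨fun h => ?_, fun s h => ?_⟩
  · simp [herm_apply, (hA i j).1 h, (hA j i).1 h.symm]
  · simp [herm_apply, (hA i j).2 s h, (hA j i).2 s h.symm]

/-- The normalised partial trace over the site `x`, tensored with the identity on `x`. -/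
def siteAverage (x : V) (A : Op V q) : Op V q :=
  fun i j => if i x = j x then (q : ℂ)⁻¹ * ∑ s, A (update i x s) (update j x s) else 0

/-- Each summand fixes the value `s` at `x` and compresses to the configurations with value `t`
there. Both operations preserve positivity, so positivity of the average can be read off. -/
lemma siteAverage_eq_sum (x : V) (A : Op V q) :
    siteAverage x A = (q : ℂ)⁻¹ • ∑ s : Fin q, ∑ t : Fin q,
      (Matrix.diagonal fun i : V → Fin q => if i x = t then (1 : ℂ) else 0)ᴴ *
        A.submatrix (fun i => update i x s) (fun i => update i x s) *
        Matrix.diagonal fun i : V → Fin q => if i x = t then (1 : ℂ) else 0 := by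
  ext i j
  have hd : ∀ t : Fin q, (Matrix.diagonal fun i : V → Fin q => if i x = t then (1 : ℂ) else 0)ᴴ =
      Matrix.diagonal fun i : V → Fin q => if i x = t then (1 : ℂ) else 0 := by
    intro t
    rw [Matrix.diagonal_conjTranspose]
    congr 1
    funext i
    simp [apply_ite]
  simp only [hd, siteAverage, Matrix.smul_apply, Matrix.sum_apply, Matrix.mul_diagonal,
    Matrix.diagonal_mul, Matrix.submatrix_apply, smul_eq_mul]
  split_ifs with h
  · simp [h]
  · rw [Finset.sum_eq_zero, mul_zero]
    intro s _
    refine Finset.sum_eq_zero fun t _ => ?_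
    by_cases ht : i x = t
    · have : j x ≠ t := fun h' => h (ht.trans h'.symm)
      simp [this]
    · simp [ht]

lemma posSemidef_siteAverage (x : V) {P : Op V q} (hP : P.PosSemidef) :
    (siteAverage x P).PosSemidef := by
  rw [siteAverage_eq_sum]
  refine Matrix.PosSemidef.smul ?_ (by positivity)
  refine Matrix.posSemidef_sum _ fun s _ => Matrix.posSemidef_sum _ fun t _ => ?_
  exact (hP.submatrix _).conjTranspose_mul_mul_same _

lemma isHermitian_siteAverage (x : V) {A : Op V q} (hA : A.IsHermitian) :
    (siteAverage x A).IsHermitian := by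
  ext i j
  rw [Matrix.conjTranspose_apply]
  simp only [siteAverage, eq_comm (a := j x)]
  split_ifs
  · simp only [star_mul', star_inv₀, star_natCast, star_sum]
    congr 1
    exact Finset.sum_congr rfl fun s _ => hA.apply _ _
  · simp

lemma actsOff_siteAverage (x : V) (A : Op V q) : ActsOff x (siteAverage x A) := by
  intro i j
  refine ⟨fun h => if_neg h, fun s h => ?_⟩
  simp [siteAverage, h]

lemma ActsOff.siteAverage {x y : V} (hxy : y ≠ x) {A : Op V q} (hA : ActsOff y A) :
    ActsOff y (siteAverage x A) := by
  intro i j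
  refine ⟨fun h => ?_, fun s h => ?_⟩
  · simp only [QuantumSpin.siteAverage]
    split_ifs
    · rw [Finset.sum_eq_zero, mul_zero]
      intro s _
      exact (hA _ _).1 (by simpa [hxy] using h)
    · rfl
  · simp only [QuantumSpin.siteAverage, Function.update_of_ne hxy.symm]
    split_ifs
    · congr 1
      refine Finset.sum_congr rfl fun t _ => ?_
      rw [Function.update_comm hxy, Function.update_comm hxy]
      exact (hA _ _).2 s (by simpa [hxy] using h)
    · rfl

lemma partialTrace_sub_siteAverage [NeZero q] (x : V) (A : Op V q) :
    partialTrace x (A - siteAverage x A) = 0 := by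
  rw [partialTrace_eq_zero_iff]
  intro i j
  simp [siteAverage, Finset.sum_sub_distrib, mul_inv_cancel_left₀ (NeZero.ne (q : ℂ))]

lemma trace_eq_zero_of_partialTrace {x : V} {A : Op V q} (h : partialTrace x A = 0) :
    A.trace = 0 := by
  have h1 : ActsOff x (1 : Op V q) := by
    intro i j
    refine ⟨fun h => Matrix.one_apply_ne fun h' => h (congrFun h' x), fun s h => ?_⟩
    simp only [Matrix.one_apply]
    congr 1
    refine propext ⟨fun h' => ?_, fun h' => by rw [h']⟩
    funext y
    by_cases hy : y = x
    · rw [hy, h]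
    · simpa [hy] using congrFun h' y
  simpa using h1.trace_mul_eq_zero h

lemma trace_siteAverage [NeZero q] (x : V) (A : Op V q) : (siteAverage x A).trace = A.trace := by
  have := trace_eq_zero_of_partialTrace (partialTrace_sub_siteAverage x A)
  rw [Matrix.trace_sub, sub_eq_zero] at this
  exact this.symm

/-- Moving a configuration to `k` one site at a time leaves the diagonal entries unchanged, and an
off-diagonal entry vanishes because of any site where its two indices differ. -/
lemma eq_smul_one_of_actsOff {A : Op V q} (hA : ∀ x, ActsOff x A) (k : V → Fin q) :
    A = A k k • (1 : Op V q) := by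
  have key : ∀ (i : V → Fin q) (T : Finset V), A (T.piecewise k i) (T.piecewise k i) = A i i := by
    intro i T
    induction T using Finset.induction_on with
    | empty => simp
    | insert x T hx ih =>
      rw [Finset.piecewise_insert, (hA x _ _).2 _ rfl, ih]
  ext i j
  rw [Matrix.smul_apply, Matrix.one_apply]
  split_ifs with h
  · subst h
    rw [← key i Finset.univ]
    simp
  · obtain ⟨x, hx⟩ := Function.ne_iff.mp h
    simp [(hA x i j).1 hx]

end SiteAverage

/-! ## The quantum `W₁` norm -/

section W1Norm

variable {V : Type*} [Fintype V] [DecidableEq V] {q : ℕ}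

/-- The family `D` is one of the decompositions that define the quantum `W₁` norm of `Δ`. -/
def IsW1Decomposition (Δ : Op V q) (D : V → Op V q) : Prop :=
  (∀ x, (D x).IsHermitian ∧ (D x).trace = 0 ∧ partialTrace x (D x) = 0) ∧ ∑ x, D x = Δ

lemma w1Norm_le {Δ : Op V q} {D : V → Op V q} (hD : IsW1Decomposition Δ D) :
    w1Norm Δ ≤ (1 / 2) * ∑ x, traceNorm (D x) := by
  refine mul_le_mul_of_nonneg_left (csInf_le ⟨0, ?_⟩ ⟨D, hD.1, hD.2, rfl⟩) (by norm_num)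
  rintro _ ⟨D, -, -, rfl⟩
  exact Finset.sum_nonneg fun x _ => traceNorm_nonneg _

lemma w1Norm_nonneg (Δ : Op V q) : 0 ≤ w1Norm Δ := by
  refine mul_nonneg (by norm_num) (Real.sInf_nonneg ?_)
  rintro _ ⟨D, -, -, rfl⟩
  exact Finset.sum_nonneg fun x _ => traceNorm_nonneg _

/-- A decomposition has to exist because the real `sInf ∅` is `0`, which would make `w1Norm` vanish.
-/
lemma le_w1Norm {Δ : Op V q} (hne : ∃ D, IsW1Decomposition Δ D) {c : ℝ}
    (h : ∀ D, IsW1Decomposition Δ D → c ≤ (1 / 2) * ∑ x, traceNorm (D x)) : c ≤ w1Norm Δ := by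
  obtain ⟨D, hD⟩ := hne
  have : 2 * c ≤ sInf {s : ℝ | ∃ D : V → Op V q,
      (∀ x, (D x).IsHermitian ∧ (D x).trace = 0 ∧ partialTrace x (D x) = 0) ∧
        ∑ x, D x = Δ ∧ s = ∑ x, traceNorm (D x)} := by
    refine le_csInf ⟨_, D, hD.1, hD.2, rfl⟩ ?_
    rintro _ ⟨D, h1, h2, rfl⟩
    linarith [h D ⟨h1, h2⟩]
  rw [w1Norm]
  linarith

lemma partialTrace_add (x : V) (A B : Op V q) :
    partialTrace x (A + B) = partialTrace x A + partialTrace x B := by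
  ext i j
  simp [partialTrace, Finset.sum_add_distrib]

lemma partialTrace_smul (x : V) (c : ℝ) (A : Op V q) :
    partialTrace x (c • A) = c • partialTrace x A := by
  ext i j
  simp [partialTrace, Finset.mul_sum]

/-- The sites of `T` are averaged out one after another, and `D x` is the change made at `x`. It is
a difference of two positive operators of trace `Tr P`, whence the bound `2 Tr P`. -/
lemma exists_telescope [NeZero q] {P : Op V q} (hP : P.PosSemidef) (T : Finset V) :
    ∃ (P' : Op V q) (D : V → Op V q), P'.PosSemidef ∧ P'.trace = P.trace ∧
      (∀ x ∈ T, ActsOff x P') ∧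
      (∀ x, (D x).IsHermitian ∧ partialTrace x (D x) = 0 ∧ traceNorm (D x) ≤ 2 * P.trace.re) ∧
      P = P' + ∑ x ∈ T, D x := by
  induction T using Finset.induction_on with
  | empty =>
    refine ⟨P, 0, hP, rfl, by simp, fun x => ⟨Matrix.isHermitian_zero, ?_, ?_⟩, by simp⟩
    · ext; simp [partialTrace]
    · rw [Pi.zero_apply, traceNorm_zero]
      have := (Complex.nonneg_iff.mp hP.trace_nonneg).1
      linarith
  | insert x T hx ih =>
    obtain ⟨P', D, hP', htr, hoff, hD, hsum⟩ := ih
    have hE := posSemidef_siteAverage x hP'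
    refine ⟨siteAverage x P', Function.update D x (P' - siteAverage x P'), hE,
      (trace_siteAverage x P').trans htr, ?_, ?_, ?_⟩
    · intro y hy
      obtain rfl | hy := Finset.mem_insert.mp hy
      · exact actsOff_siteAverage _ _
      · exact (hoff y hy).siteAverage (ne_of_mem_of_not_mem hy hx)
    · intro y
      by_cases hy : y = x
      · subst hy
        rw [Function.update_self]
        refine ⟨hP'.isHermitian.sub hE.isHermitian, partialTrace_sub_siteAverage _ _, ?_⟩
        refine (traceNorm_sub_le hP'.isHermitian hE.isHermitian).trans ?_
        rw [traceNorm_of_posSemidef hP', traceNorm_of_posSemidef hE, trace_siteAverage, htr]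
        linarith
      · rw [Function.update_of_ne hy]
        exact hD y
    · rw [Finset.sum_insert hx, Function.update_self,
        Finset.sum_congr rfl fun y hy => Function.update_of_ne (ne_of_mem_of_not_mem hy hx) _ _]
      rw [hsum]
      abel_nf

/-- The difference of two density operators has a `W₁` decomposition, with uniformly bounded
terms. -/
lemma exists_isW1Decomposition [NeZero q] {P Q : Op V q} (hP : P.PosSemidef) (hQ : Q.PosSemidef)
    (hP1 : P.trace = 1) (hQ1 : Q.trace = 1) :
    ∃ D, IsW1Decomposition (P - Q) D ∧ ∀ x, traceNorm (D x) ≤ 4 := by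
  obtain ⟨P', D, -, htrP, hoffP, hD, hsumP⟩ := exists_telescope hP Finset.univ
  obtain ⟨Q', E, -, htrQ, hoffQ, hE, hsumQ⟩ := exists_telescope hQ Finset.univ
  -- Averaged over all sites, both density operators become the maximally mixed one, so only the
  -- telescoping differences remain.
  have hPQ : P' = Q' := by
    have h1 := eq_smul_one_of_actsOff (fun x => hoffP x (Finset.mem_univ x)) 0
    have h2 := eq_smul_one_of_actsOff (fun x => hoffQ x (Finset.mem_univ x)) 0
    have h3 : P'.trace = Q'.trace := by rw [htrP, htrQ, hP1, hQ1]
    rw [h1, h2, Matrix.trace_smul, Matrix.trace_smul] at h3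
    have h4 : (1 : Op V q).trace ≠ 0 := by
      rw [Matrix.trace_one]
      exact_mod_cast Fintype.card_ne_zero
    rw [h1, h2, mul_right_cancel₀ h4 h3]
  refine ⟨fun x => D x - E x, ⟨fun x => ?_, ?_⟩, fun x => ?_⟩
  · have h : partialTrace x (D x - E x) = 0 := by
      rw [sub_eq_add_neg, partialTrace_add, ← neg_one_smul ℝ, partialTrace_smul, (hD x).2.1,
        (hE x).2.1, smul_zero, add_zero]
    exact ⟨(hD x).1.sub (hE x).1, trace_eq_zero_of_partialTrace h, h⟩
  · rw [Finset.sum_sub_distrib, hsumP, hsumQ, hPQ]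
    abel
  · refine (traceNorm_sub_le (hD x).1 (hE x).1).trans ?_
    have h1 := (hD x).2.2
    have h2 := (hE x).2.2
    rw [hP1, Complex.one_re] at h1
    rw [hQ1, Complex.one_re] at h2
    linarith

lemma w1Norm_sub_le [NeZero q] {P Q : Op V q} (hP : P.PosSemidef) (hQ : Q.PosSemidef)
    (hP1 : P.trace = 1) (hQ1 : Q.trace = 1) : w1Norm (P - Q) ≤ 2 * Fintype.card V := by
  obtain ⟨D, hD, h⟩ := exists_isW1Decomposition hP hQ hP1 hQ1
  have h1 := w1Norm_le hD
  have h2 : ∑ x, traceNorm (D x) ≤ ∑ _x : V, (4 : ℝ) := Finset.sum_le_sum fun x _ => h x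
  rw [Finset.sum_const, Finset.card_univ, nsmul_eq_mul] at h2
  linarith

end W1Norm

/-! ## Duality for the quantum `W₁` norm -/

section FiniteDuality

variable {V : Type*} [Fintype V] [DecidableEq V] {q : ℕ}

lemma eq_zero_of_re_trace_mul_conjTranspose {A : Op V q} (h : (A * Aᴴ).trace.re = 0) : A = 0 := by
  rw [← Matrix.trace_mul_conjTranspose_self_eq_zero_iff]
  have := (Complex.nonneg_iff.mp (Matrix.posSemidef_self_mul_conjTranspose A).trace_nonneg).2
  exact Complex.ext h this.symm

/-- Every real-linear functional has the form `A ↦ Re Tr[H A]`. -/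
lemma exists_eq_re_trace_mul (φ : Op V q →ₗ[ℝ] ℝ) :
    ∃ H : Op V q, ∀ A, φ A = (H * A).trace.re := by
  let T : Op V q →ₗ[ℝ] Module.Dual ℝ (Op V q) :=
    LinearMap.mk₂ ℝ (fun H A => (H * A).trace.re)
      (fun _ _ _ => by simp [add_mul]) (fun c H A => by simp)
      (fun _ _ _ => by simp [mul_add]) (fun c H A => by simp)
  have hT : Function.Injective T := by
    refine (injective_iff_map_eq_zero T).mpr fun H hH => ?_
    exact eq_zero_of_re_trace_mul_conjTranspose (LinearMap.congr_fun hH Hᴴ)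
  obtain ⟨H, hH⟩ := (LinearMap.injective_iff_surjective_of_finrank_eq_finrank
    (Subspace.dual_finrank_eq (K := ℝ) (V := Op V q)).symm).mp hT φ
  exact ⟨H, fun A => (LinearMap.congr_fun hH A).symm⟩

/-- The families `D` of self-adjoint operators with `Tr_x (D x) = 0`. -/
def tracelessFamilies (V : Type*) [Fintype V] [DecidableEq V] (q : ℕ) :
    Submodule ℝ (V → Op V q) where
  carrier := {D | ∀ x, (D x).IsHermitian ∧ partialTrace x (D x) = 0}
  zero_mem' x := ⟨Matrix.isHermitian_zero, by ext; simp [partialTrace]⟩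
  add_mem' hD hE x := ⟨(hD x).1.add (hE x).1, by
    rw [Pi.add_apply, partialTrace_add, (hD x).2, (hE x).2, add_zero]⟩
  smul_mem' c D hD x := ⟨by
    rw [Pi.smul_apply, Matrix.IsHermitian, Matrix.conjTranspose_smul, star_trivial, (hD x).1.eq], by
    rw [Pi.smul_apply, partialTrace_smul, (hD x).2, smul_zero]⟩

lemma isW1Decomposition_iff {Δ : Op V q} {D : V → Op V q} :
    IsW1Decomposition Δ D ↔ D ∈ tracelessFamilies V q ∧ ∑ x, D x = Δ :=
  and_congr_left fun _ => forall_congr' fun _ => and_congr_right fun _ =>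
    ⟨fun h => h.2, fun h => ⟨trace_eq_zero_of_partialTrace h, h⟩⟩

lemma single_mem_tracelessFamilies {x : V} {D : Op V q} (hD : D.IsHermitian)
    (h : partialTrace x D = 0) : Pi.single x D ∈ tracelessFamilies V q := by
  intro y
  by_cases hy : y = x
  · subst hy
    simpa using ⟨hD, h⟩
  · rw [Pi.single_eq_of_ne hy]
    exact (tracelessFamilies V q).zero_mem y

/-- The linear functional on the families of operators, bounded by half of the sum of the trace
norms, that attains the quantum `W₁` norm. -/
lemma exists_functional_eq_w1Norm {Δ : Op V q} (hΔ : Δ ≠ 0) :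
    ∃ g : (V → Op V q) →ₗ[ℝ] ℝ,
      (∀ D, IsW1Decomposition Δ D → g D = w1Norm Δ) ∧
      (∀ D, IsW1Decomposition 0 D → g D = 0) ∧
      ∀ D, g D ≤ (1 / 2) * ∑ x, traceNorm (herm (D x)) := by
  let sumMap : (V → Op V q) →ₗ[ℝ] Op V q := ∑ x, LinearMap.proj x
  have h_sum : ∀ D, sumMap D = ∑ x, D x := fun D => by simp [sumMap]
  obtain ⟨l, hl⟩ := SeparatingDual.exists_eq_one (R := ℝ) hΔ
  -- On admissible families with sum `t • Δ` the functional is `t * w1Norm Δ`. The dominating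
  -- function applies `herm` because it must be sublinear on all families, and the triangle
  -- inequality is used for Hermitian operators only.
  let dom : Submodule ℝ (V → Op V q) := tracelessFamilies V q ⊓ (Submodule.span ℝ {Δ}).comap sumMap
  let f : (V → Op V q) →ₗ.[ℝ] ℝ :=
    ⟨dom, ((w1Norm Δ) • ((l : Op V q →ₗ[ℝ] ℝ) ∘ₗ sumMap)) ∘ₗ dom.subtype⟩
  have hext : ∃ g : (V → Op V q) →ₗ[ℝ] ℝ, (∀ D : f.domain, g D = f D) ∧
      ∀ D, g D ≤ (1 / 2) * ∑ x, traceNorm (herm (D x)) := by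
    refine exists_extension_of_le_sublinear f _ ?_ ?_ ?_
    · intro c hc D
      simp only [Pi.smul_apply, map_smul, traceNorm_smul hc.le, ← Finset.mul_sum]
      ring
    · intro D E
      rw [← mul_add, ← Finset.sum_add_distrib]
      refine mul_le_mul_of_nonneg_left (Finset.sum_le_sum fun x _ => ?_) (by norm_num)
      rw [Pi.add_apply, map_add]
      exact traceNorm_add_le (isHermitian_herm _) (isHermitian_herm _)
    · rintro ⟨D, h1, h2⟩
      obtain ⟨t, ht⟩ := Submodule.mem_span_singleton.mp h2
      change w1Norm Δ * l (sumMap D) ≤ (1 / 2) * ∑ x, traceNorm (herm (D x))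
      rw [← ht, map_smul, hl, smul_eq_mul, mul_one]
      rw [Finset.sum_congr rfl fun x _ => by rw [herm_of_isHermitian (h1 x).1]]
      obtain h | h := le_or_gt t 0
      · exact (mul_nonpos_of_nonneg_of_nonpos (w1Norm_nonneg Δ) h).trans
          (mul_nonneg (by norm_num) (Finset.sum_nonneg fun x _ => traceNorm_nonneg _))
      -- For `t > 0`, rescaling by `t⁻¹` gives a decomposition of `Δ` itself, so domination is the
      -- definition of the infimum.
      · have hd : IsW1Decomposition Δ (t⁻¹ • D) := by
          refine isW1Decomposition_iff.mpr ⟨Submodule.smul_mem _ _ h1, ?_⟩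
          rw [← h_sum, map_smul, ← ht, smul_smul, inv_mul_cancel₀ h.ne', one_smul]
        have := w1Norm_le hd
        simp only [Pi.smul_apply, traceNorm_smul (inv_nonneg.mpr h.le), ← Finset.mul_sum] at this
        calc w1Norm Δ * t ≤ (1 / 2 * (t⁻¹ * ∑ x, traceNorm (D x))) * t :=
              mul_le_mul_of_nonneg_right this h.le
          _ = _ := by field_simp
  obtain ⟨g, hg, hgN⟩ := hext
  refine ⟨g, fun D hD => ?_, fun D hD => ?_, hgN⟩
  · obtain ⟨h1, h2⟩ := isW1Decomposition_iff.mp hD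
    have hm : D ∈ dom := Submodule.mem_inf.mpr ⟨h1, by
      rw [Submodule.mem_comap, h_sum, h2]; exact Submodule.mem_span_singleton_self Δ⟩
    have := hg ⟨D, hm⟩
    rw [this]
    change w1Norm Δ * l (sumMap D) = _
    rw [h_sum, h2, hl, mul_one]
  · obtain ⟨h1, h2⟩ := isW1Decomposition_iff.mp hD
    have hm : D ∈ dom := Submodule.mem_inf.mpr ⟨h1, by
      rw [Submodule.mem_comap, h_sum, h2]; exact Submodule.zero_mem _⟩
    have := hg ⟨D, hm⟩
    rw [this]
    change w1Norm Δ * l (sumMap D) = _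
    rw [h_sum, h2, map_zero, mul_zero]

/-- The quantum `W₁` norm is attained by an observable whose dependence on each site is at most
`1`. -/
theorem exists_observable_eq_w1Norm [NeZero q] {Δ : Op V q}
    (hne : ∃ D, IsW1Decomposition Δ D) :
    ∃ H : Op V q, H.IsHermitian ∧ (H * Δ).trace.re = w1Norm Δ ∧
      ∀ x, ∃ A : Op V q, A.IsHermitian ∧ ActsOff x A ∧ ‖H - A‖ ≤ 1 / 2 := by
  by_cases hΔ : Δ = 0
  · refine ⟨0, Matrix.isHermitian_zero, ?_, fun x => ⟨0, Matrix.isHermitian_zero, ?_, by simp⟩⟩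
    · have h : IsW1Decomposition Δ (0 : V → Op V q) :=
        isW1Decomposition_iff.mpr ⟨Submodule.zero_mem _, by simp [hΔ]⟩
      have := w1Norm_le h
      simp only [Pi.zero_apply, traceNorm_zero, Finset.sum_const_zero, mul_zero] at this
      rw [zero_mul, Matrix.trace_zero, Complex.zero_re]
      exact le_antisymm (w1Norm_nonneg Δ) this
    · exact fun i j => ⟨fun _ => rfl, fun _ _ => rfl⟩
  obtain ⟨g, hgΔ, hg0, hgN⟩ := exists_functional_eq_w1Norm hΔ
  let S := tracelessFamilies V q
  let sumMap : (V → Op V q) →ₗ[ℝ] Op V q := ∑ x, LinearMap.proj x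
  have h_sum : ∀ D, sumMap D = ∑ x, D x := fun D => by simp [sumMap]
  -- On admissible families `g` kills the kernel of the sum map, so there it factors as `φ` of the
  -- sum.
  have hmem : g ∘ₗ S.subtype ∈ LinearMap.range (sumMap ∘ₗ S.subtype).dualMap := by
    rw [LinearMap.range_dualMap_eq_dualAnnihilator_ker, Submodule.mem_dualAnnihilator]
    rintro ⟨D, hD⟩ hker
    refine hg0 D (isW1Decomposition_iff.mpr ⟨hD, ?_⟩)
    rw [← h_sum]
    exact hker
  obtain ⟨φ, hφ⟩ := hmem
  have hφ' : ∀ D ∈ S, φ (∑ x, D x) = g D := fun D hD => by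
    rw [← h_sum]
    exact LinearMap.congr_fun hφ ⟨D, hD⟩
  obtain ⟨H, hH⟩ := exists_eq_re_trace_mul φ
  refine ⟨herm H, isHermitian_herm H, ?_, fun x => ?_⟩
  · obtain ⟨D, hD⟩ := hne
    have hΔh : Δ.IsHermitian := by
      rw [← hD.2]
      exact isSelfAdjoint_sum _ fun x _ => (hD.1 x).1
    rw [re_trace_herm_mul H hΔh, ← hH, ← hgΔ D hD, ← hφ' D (isW1Decomposition_iff.mp hD).1, hD.2]
  · obtain ⟨G, hG⟩ := exists_eq_re_trace_mul (g ∘ₗ LinearMap.single ℝ (fun _ => Op V q) x)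
    have hGle : ‖herm G‖ ≤ 1 / 2 := by
      refine norm_le_of_re_trace_mul_le (isHermitian_herm G) (by norm_num) fun D hD => ?_
      rw [re_trace_herm_mul G hD, ← hG]
      refine (hgN _).trans_eq ?_
      rw [Finset.sum_eq_single x]
      · simp [herm_of_isHermitian hD]
      · intro y _ hy
        simp [hy, traceNorm_zero]
      · simp
    -- Against Hermitian `D` with `Tr_x D = 0`, `H` and `G` have the same pairing. Hence `B` is
    -- orthogonal to `B - siteAverage x B`; so is `siteAverage x B`, and the difference, orthogonal
    -- to itself, vanishes.
    let B := herm H - herm G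
    have hB : B.IsHermitian := (isHermitian_herm H).sub (isHermitian_herm G)
    have hA := isHermitian_siteAverage x hB
    have hD := hB.sub hA
    have hD0 := partialTrace_sub_siteAverage x B
    have hB0 : B - siteAverage x B = 0 := by
      refine eq_zero_of_re_trace_mul_conjTranspose ?_
      rw [hD.eq]
      nth_rewrite 1 [sub_mul]
      rw [Matrix.trace_sub, (actsOff_siteAverage x B).trace_mul_eq_zero hD0, sub_zero]
      nth_rewrite 1 [show B = herm H - herm G from rfl]
      rw [sub_mul, Matrix.trace_sub, Complex.sub_re, re_trace_herm_mul H hD,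
        re_trace_herm_mul G hD, ← hH, ← hG, sub_eq_zero]
      have := hφ' _ (single_mem_tracelessFamilies hD hD0)
      rw [Finset.sum_pi_single'] at this
      simpa using this
    refine ⟨siteAverage x B, hA, actsOff_siteAverage x B, ?_⟩
    rw [← sub_eq_zero.mp hB0]
    simpa [B] using hGle

end FiniteDuality

variable {d q : ℕ}

/-! ## Local operators on different regions -/

section Local

lemma trace_incl {Λ Λ' : Finset (Site d)} (h : Λ ≤ Λ') (A : Op Λ q) :
    (incl h A).trace = A.trace * Fintype.card ({y : Λ' // (y : Site d) ∉ Λ} → Fin q) := by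
  rw [← Matrix.trace_one, ← Matrix.trace_kronecker]
  exact Equiv.sum_comp (splitConfig h) fun p =>
    (A ⊗ₖ (1 : Op {y : Λ' // (y : Site d) ∉ Λ} q)) p p

/-- The embedding commutes with the absolute value, by uniqueness of the positive square root. The
dimension factor is the same as for the trace, so it cancels when the two are compared. -/
lemma traceNorm_incl {Λ Λ' : Finset (Site d)} (h : Λ ≤ Λ') (A : Op Λ q) :
    traceNorm (incl h A) = traceNorm A * Fintype.card ({y : Λ' // (y : Site d) ∉ Λ} → Fin q) := by
  have h1 : CFC.abs (incl h A) = incl h (CFC.abs A) := by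
    refine CFC.sqrt_unique ?_ ?_
    · rw [← map_mul, CFC.abs_mul_abs, map_mul, map_star]
    · obtain ⟨C, hC⟩ := CStarAlgebra.nonneg_iff_eq_star_mul_self.mp (CFC.abs_nonneg A)
      rw [hC, map_mul, map_star]
      exact star_mul_self_nonneg _
  change (CFC.abs (incl h A)).trace.re = (CFC.abs A).trace.re * _
  rw [h1, trace_incl, ← Complex.ofReal_natCast, Complex.re_mul_ofReal]

lemma isHermitian_incl {Λ Λ' : Finset (Site d)} (h : Λ ≤ Λ') {A : Op Λ q} (hA : A.IsHermitian) :
    (incl h A).IsHermitian :=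
  (IsSelfAdjoint.map (show IsSelfAdjoint A from hA) (incl h) :)

lemma actsOff_incl {X Λ : Finset (Site d)} (h : X ≤ Λ) (A : Op X q) {x : Λ}
    (hx : (x : Site d) ∉ X) : ActsOff x (incl h A) := by
  intro i j
  refine ⟨fun hij => ?_, fun s hij => ?_⟩
  · rw [incl_apply, if_neg fun H => hij (H x hx)]
  · have hne : ∀ y : X, (⟨y, h y.2⟩ : Λ) ≠ x := fun y hy => hx (by rw [← hy]; exact y.2)
    have hu : ∀ i : Λ → Fin q, (fun y : X => Function.update i x s ⟨y, h y.2⟩) =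
        fun y : X => i ⟨y, h y.2⟩ := fun i => funext fun y => Function.update_of_ne (hne y) _ _
    rw [incl_apply, incl_apply, hu, hu]
    congr 1
    refine propext (forall₂_congr fun y _ => ?_)
    by_cases hyx : y = x
    · simp [hyx, hij]
    · simp [hyx]

lemma partialTrace_incl {Λ Λ' : Finset (Site d)} (h : Λ ≤ Λ') {D : Op Λ q} (x : Λ)
    (hD : partialTrace x D = 0) : partialTrace (⟨x, h x.2⟩ : Λ') (incl h D) = 0 := by
  rw [partialTrace_eq_zero_iff] at hD ⊢
  intro i j
  have hu : ∀ (i : Λ' → Fin q) (s : Fin q),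
      (fun y : Λ => Function.update i (⟨x, h x.2⟩ : Λ') s ⟨y, h y.2⟩) =
        Function.update (fun y : Λ => i ⟨y, h y.2⟩) x s := by
    intro i s
    funext y
    by_cases hyx : y = x
    · subst hyx; simp
    · have : (⟨y, h y.2⟩ : Λ') ≠ ⟨x, h x.2⟩ := fun h' => hyx (Subtype.ext (congrArg (·.1) h'))
      simp [hyx, this]
  have hc : ∀ s : Fin q, (∀ y : Λ', (y : Site d) ∉ Λ →
      Function.update i (⟨x, h x.2⟩ : Λ') s y = Function.update j (⟨x, h x.2⟩ : Λ') s y) ↔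
      ∀ y : Λ', (y : Site d) ∉ Λ → i y = j y := by
    refine fun s => forall₂_congr fun y hy => ?_
    have : y ≠ ⟨x, h x.2⟩ := fun h' => hy (by rw [h']; exact x.2)
    simp [this]
  simp only [incl_apply, hu, hc]
  split_ifs
  · exact hD _ _
  · exact Finset.sum_const_zero

variable [NeZero q]

/-- If the local operator `H` is at distance at most `c` from an operator that does not act on
`x`, then it pairs with the operators with zero partial trace over `x` with norm at most `c`. -/
lemma re_trace_mul_le_of_norm_emb_sub_le {Λ X : Finset (Site d)} {x : Λ} (hx : (x : Site d) ∉ X)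
    {H D : Op Λ q} (hD : D.IsHermitian) (hD0 : partialTrace x D = 0) (A : Op X q) {c : ℝ}
    (hc : ‖emb Λ H - emb X A‖ ≤ c) : (H * D).trace.re ≤ c * traceNorm D := by
  classical
  have h₁ : Λ ≤ Λ ∪ X := Finset.subset_union_left
  have h₂ : X ≤ Λ ∪ X := Finset.subset_union_right
  have hc' : ‖incl h₁ H - incl h₂ A‖ ≤ c := by
    rw [← norm_emb, map_sub, emb_incl, emb_incl]
    exact hc
  have hle := re_trace_mul_le (incl h₁ H - incl h₂ A) (isHermitian_incl h₁ hD)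
  rw [sub_mul, Matrix.trace_sub, (actsOff_incl h₂ A (x := ⟨x, h₁ x.2⟩) hx).trace_mul_eq_zero
    (partialTrace_incl h₁ x hD0), sub_zero, ← map_mul, trace_incl, traceNorm_incl,
    ← Complex.ofReal_natCast, Complex.re_mul_ofReal, ← mul_assoc] at hle
  have hpos : (0 : ℝ) < Fintype.card ({y : (Λ ∪ X : Finset (Site d)) // (y : Site d) ∉ Λ} → Fin q) :=
    by exact_mod_cast Fintype.card_pos
  exact (le_of_mul_le_mul_right hle hpos).trans
    (mul_le_mul_of_nonneg_right hc' (traceNorm_nonneg D))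

/-- The easy half of finite duality: in a decomposition of `Δ`, the component at `x` does not see an
operator off `x`. The regions `X` need not lie in `Λ`, since the Lipschitz constant allows any
observable off the site. -/
lemma re_trace_mul_le_w1Norm {Λ : Finset (Site d)} {Δ H : Op Λ q}
    (hne : ∃ D, IsW1Decomposition Δ D) {c : ℝ} (hc : 0 < c)
    (hH : ∀ x : Λ, ∃ (X : Finset (Site d)) (A : Op X q), (x : Site d) ∉ X ∧
      ‖emb Λ H - emb X A‖ ≤ c) : (H * Δ).trace.re ≤ 2 * c * w1Norm Δ := by
  have : (H * Δ).trace.re / (2 * c) ≤ w1Norm Δ := by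
    refine le_w1Norm hne fun D hD => ?_
    rw [div_le_iff₀ (by positivity), ← hD.2, Finset.mul_sum, Matrix.trace_sum, Complex.re_sum]
    calc ∑ x, (H * D x).trace.re ≤ ∑ x, c * traceNorm (D x) := by
          refine Finset.sum_le_sum fun x _ => ?_
          obtain ⟨X, A, hx, hA⟩ := hH x
          exact re_trace_mul_le_of_norm_emb_sub_le hx (hD.1 x).1 (hD.1 x).2.2 A hA
      _ = _ := by rw [← Finset.mul_sum]; ring
  rwa [div_le_iff₀ (by positivity), mul_comm] at this

/-- The elements of the quasi-local algebra that are supported in a finite subset of `Γ`. -/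
def localIn (Γ : Set (Site d)) : Set (QuasiLocal d q) :=
  {a | ∃ (X : Finset (Site d)) (A : Op X q), (X : Set (Site d)) ⊆ Γ ∧ a = emb X A}

lemma emb_mem_localIn {Γ : Set (Site d)} {X : Finset (Site d)} (h : (X : Set (Site d)) ⊆ Γ)
    (A : Op X q) : emb X A ∈ localIn (q := q) Γ := ⟨X, A, h, rfl⟩

lemma smul_mem_localIn {Γ : Set (Site d)} {a : QuasiLocal d q} (c : ℂ) (ha : a ∈ localIn Γ) :
    c • a ∈ localIn Γ := by
  obtain ⟨X, A, h, rfl⟩ := ha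
  exact ⟨X, c • A, h, (map_smul _ _ _).symm⟩

lemma add_mem_localIn {Γ : Set (Site d)} {a b : QuasiLocal d q} (ha : a ∈ localIn Γ)
    (hb : b ∈ localIn Γ) : a + b ∈ localIn Γ := by
  classical
  obtain ⟨X, A, h, rfl⟩ := ha
  obtain ⟨Y, B, h', rfl⟩ := hb
  refine ⟨X ∪ Y, incl Finset.subset_union_left A + incl Finset.subset_union_right B, ?_, ?_⟩
  · rw [Finset.coe_union]
    exact Set.union_subset h h'
  · rw [map_add, emb_incl, emb_incl]

lemma sum_mem_localIn {Γ : Set (Site d)} {ι : Type*} (s : Finset ι) {f : ι → QuasiLocal d q}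
    (hf : ∀ i ∈ s, f i ∈ localIn Γ) : ∑ i ∈ s, f i ∈ localIn Γ := by
  classical
  induction s using Finset.induction_on with
  | empty => exact ⟨∅, 0, by simp, by simp⟩
  | insert i s hi ih =>
    rw [Finset.sum_insert hi]
    exact add_mem_localIn (hf i (Finset.mem_insert_self _ _))
      (ih fun j hj => hf j (Finset.mem_insert_of_mem hj))

lemma translation_mem_localIn {Γ Γ' : Set (Site d)} (x : Site d) {a : QuasiLocal d q}
    (ha : a ∈ localIn Γ) (h : ∀ y ∈ Γ, y + x ∈ Γ') : translation x a ∈ localIn Γ' := by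
  obtain ⟨X, A, hX, rfl⟩ := ha
  rw [translation_emb]
  refine emb_mem_localIn (fun y hy => ?_) _
  have := h _ (hX (sub_mem_of_mem_translate hy))
  rwa [sub_add_cancel] at this

lemma exists_emb_eq_of_mem_localIn {Λ : Finset (Site d)} {a : QuasiLocal d q}
    (ha : a ∈ localIn (Λ : Set (Site d))) : ∃ A : Op Λ q, emb Λ A = a := by
  obtain ⟨X, A, h, rfl⟩ := ha
  exact ⟨incl (Finset.coe_subset.mp h) A, emb_incl _ _⟩

/-- An operator that does not act on `x` is an element of the local algebra of the complement
of `x`. -/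
lemma ActsOff.emb_mem_localIn {Λ : Finset (Site d)} {x : Λ} {A : Op Λ q} (hA : ActsOff x A) :
    emb Λ A ∈ localIn (q := q) ({(x : Site d)}ᶜ : Set (Site d)) := by
  have hle : Λ.erase x ≤ Λ := Finset.erase_subset _ _
  let e : (Λ.erase (x : Site d) → Fin q) → (Λ → Fin q) := fun i y =>
    if h : (y : Site d) ∈ Λ.erase (x : Site d) then i ⟨y, h⟩ else 0
  have hmem : ∀ y : Λ, (y : Site d) ∈ Λ.erase (x : Site d) ↔ y ≠ x := by
    intro y
    rw [Finset.mem_erase, ne_eq, Subtype.coe_inj]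
    exact and_iff_left y.2
  have he : ∀ i : Λ → Fin q, e (fun y => i ⟨y, hle y.2⟩) = Function.update i x 0 := by
    intro i
    funext y
    by_cases hy : y = x
    · have : ¬ (y : Site d) ∈ Λ.erase (x : Site d) := fun h => (hmem y).mp h hy
      rw [hy] at this ⊢
      simp only [e, dif_neg this, Function.update_self]
    · simp only [e, dif_pos ((hmem y).mpr hy), Function.update_of_ne hy]
  let A' : Op (Λ.erase (x : Site d)) q := fun i j => A (e i) (e j)
  refine ⟨Λ.erase x, A', ?_, ?_⟩
  · intro y hy
    exact (Finset.mem_erase.mp hy).1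
  · rw [← emb_incl hle]
    congr 1
    ext i j
    rw [incl_apply]
    simp only [A', he]
    have hc : (∀ y : Λ, (y : Site d) ∉ Λ.erase (x : Site d) → i y = j y) ↔ i x = j x := by
      constructor
      · exact fun H => H x fun h => (hmem x).mp h rfl
      · intro H y hy
        have : y = x := by by_contra hne; exact hy ((hmem y).mpr hne)
        rw [this, H]
    simp only [hc]
    split_ifs with h
    · exact ((hA i j).2 0 h).symm
    · exact (hA i j).1 h

lemma emb_congr {Λ Λ' : Finset (Site d)} (h : Λ = Λ') {A : Op Λ q} {A' : Op Λ' q}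
    (hA : ∀ i j : Λ' → Fin q, A' i j = A (fun y => i ⟨y, h ▸ y.2⟩) (fun y => j ⟨y, h ▸ y.2⟩)) :
    emb Λ A = emb Λ' A' := by
  subst h
  congr 1
  ext i j
  exact (hA i j).symm

lemma mem_translate {x z : Site d} {Λ : Finset (Site d)} : z ∈ translate x Λ ↔ z - x ∈ Λ :=
  ⟨sub_mem_of_mem_translate, fun h => by simpa using add_mem_translate (x := x) h⟩

lemma translate_translate (x y : Site d) (Λ : Finset (Site d)) :
    translate y (translate x Λ) = translate (x + y) Λ := by
  ext z
  rw [mem_translate, mem_translate, mem_translate, sub_sub, add_comm]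

lemma translate_zero (Λ : Finset (Site d)) : translate 0 Λ = Λ := by
  ext z
  rw [mem_translate, sub_zero]

lemma translation_translation_emb (x y : Site d) (Λ : Finset (Site d)) (A : Op Λ q) :
    translation y (translation x (emb Λ A)) = translation (x + y) (emb Λ A) := by
  rw [translation_emb, translation_emb, translation_emb]
  refine emb_congr (translate_translate x y Λ) fun i j => ?_
  rw [opTranslate_apply, opTranslate_apply, opTranslate_apply]
  congr 1 <;> funext z <;> congr 1 <;> exact Subtype.ext (add_assoc _ _ _).symm

lemma norm_translation (x : Site d) (a : QuasiLocal d q) : ‖translation x a‖ = ‖a‖ := by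
  refine denseRange_ofLoc.induction_on (p := fun a : QuasiLocal d q => ‖translation x a‖ = ‖a‖) a
    (isClosed_eq (continuous_translationFun x).norm continuous_norm) fun a => ?_
  change ‖translationFun x (ofLoc a)‖ = _
  rw [translationFun_ofLoc, norm_ofLoc, norm_ofLoc, norm_locTranslate]

end Local

/-! ## States -/

section States

variable [NeZero q]

/-- Writing `‖a‖ - a = b* b`, positivity of the state gives both claims; no continuity of the state
is assumed. -/
lemma State.expect_isSelfAdjoint (ρ : State d q) {a : QuasiLocal d q} (ha : IsSelfAdjoint a) :
    (ρ.expect a).im = 0 ∧ (ρ.expect a).re ≤ ‖a‖ := by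
  let _ : PartialOrder (QuasiLocal d q) := CStarAlgebra.spectralOrder _
  have _ : StarOrderedRing (QuasiLocal d q) := CStarAlgebra.spectralOrderedRing _
  have h := sub_nonneg.mpr (IsSelfAdjoint.le_algebraMap_norm_self (a := a) ha)
  obtain ⟨b, hb⟩ := CStarAlgebra.nonneg_iff_eq_star_mul_self.mp h
  have h' := ρ.nonneg b
  rw [← hb, map_sub, IsScalarTower.algebraMap_apply ℝ ℂ (QuasiLocal d q),
    Algebra.algebraMap_eq_smul_one, map_smul, ρ.map_one] at h'
  have h'' := Complex.nonneg_iff.mp h'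
  simp at h''
  exact ⟨by linarith, h''.1⟩

lemma State.expect_star (ρ : State d q) (a : QuasiLocal d q) :
    ρ.expect (star a) = star (ρ.expect a) := by
  have h1 := (ρ.expect_isSelfAdjoint (IsSelfAdjoint.add_star_self a)).1
  have h2 := (ρ.expect_isSelfAdjoint (a := Complex.I • (a - star a)) (by
    rw [IsSelfAdjoint, star_smul, star_sub, star_star, Complex.star_def, Complex.conj_I, neg_smul,
      ← smul_neg, neg_sub])).1
  rw [map_smul, map_sub] at h2
  rw [map_add] at h1
  simp at h1 h2
  refine Complex.ext ?_ ?_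
  · rw [Complex.star_def, Complex.conj_re]
    linarith
  · rw [Complex.star_def, Complex.conj_im]
    linarith

lemma State.trace_marginal (ρ : State d q) (Λ : Finset (Site d)) : (ρ.marginal Λ).trace = 1 := by
  have := ρ.expect_emb Λ 1
  rw [_root_.map_one, ρ.map_one, mul_one] at this
  exact this.symm

lemma State.posSemidef_marginal (ρ : State d q) (Λ : Finset (Site d)) :
    (ρ.marginal Λ).PosSemidef := by
  have hH : (ρ.marginal Λ).IsHermitian := by
    ext i j
    rw [Matrix.conjTranspose_apply]
    change star (ρ.expect (emb Λ (Matrix.single i j 1))) = ρ.expect (emb Λ (Matrix.single j i 1))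
    rw [← ρ.expect_star, ← map_star, Matrix.star_eq_conjTranspose, Matrix.conjTranspose_single,
      star_one]
  refine Matrix.PosSemidef.of_dotProduct_mulVec_nonneg hH fun x => ?_
  obtain ⟨C, hC⟩ := CStarAlgebra.nonneg_iff_eq_star_mul_self.mp
    (Matrix.nonneg_iff_posSemidef.mpr (Matrix.posSemidef_vecMulVec_self_star x))
  have e : star x ⬝ᵥ (ρ.marginal Λ *ᵥ x) = ρ.expect (emb Λ (Matrix.vecMulVec x (star x))) := by
    rw [ρ.expect_emb, Matrix.mul_vecMulVec, Matrix.trace_vecMulVec, dotProduct_comm]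
  rw [e, hC, map_mul, map_star]
  exact ρ.nonneg _

lemma exists_isW1Decomposition_marginal (ρ σ : State d q) (Λ : Finset (Site d)) :
    ∃ D, IsW1Decomposition (ρ.marginal Λ - σ.marginal Λ) D :=
  let ⟨D, hD, _⟩ := exists_isW1Decomposition (ρ.posSemidef_marginal Λ) (σ.posSemidef_marginal Λ)
    (ρ.trace_marginal Λ) (σ.trace_marginal Λ)
  ⟨D, hD⟩

/-- The real part of the difference of the expectation values in two states. -/
def expectDiff (ρ σ : State d q) : QuasiLocal d q →ₗ[ℝ] ℝ :=
  Complex.reLm ∘ₗ (ρ.expect - σ.expect).restrictScalars ℝ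

lemma expectDiff_apply (ρ σ : State d q) (a : QuasiLocal d q) :
    expectDiff ρ σ a = (ρ.expect a).re - (σ.expect a).re := rfl

lemma expectDiff_emb (ρ σ : State d q) (Λ : Finset (Site d)) (A : Op Λ q) :
    expectDiff ρ σ (emb Λ A) = (A * (ρ.marginal Λ - σ.marginal Λ)).trace.re := by
  rw [expectDiff_apply, ρ.expect_emb, σ.expect_emb, Matrix.trace_mul_comm,
    Matrix.trace_mul_comm (σ.marginal Λ), mul_sub, Matrix.trace_sub, Complex.sub_re]

lemma expectDiff_translation {ρ σ : State d q} (hρ : ρ.IsTranslationInvariant)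
    (hσ : σ.IsTranslationInvariant) (x : Site d) (a : QuasiLocal d q) :
    expectDiff ρ σ (translation x a) = expectDiff ρ σ a := by
  rw [expectDiff_apply, expectDiff_apply, hρ, hσ]

lemma expectDiff_le (ρ σ : State d q) {a : QuasiLocal d q} (ha : IsSelfAdjoint a) :
    expectDiff ρ σ a ≤ 2 * ‖a‖ := by
  have h1 := (ρ.expect_isSelfAdjoint ha).2
  have h2 := (σ.expect_isSelfAdjoint ha.neg).2
  rw [map_neg, Complex.neg_re, norm_neg] at h2
  rw [expectDiff_apply]
  linarith

end States

variable [NeZero q]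


/-! ## Interactions generated by one local observable -/

section LocalInteraction

/-- The values of `ρ(E_Φ) - σ(E_Φ)` for the interactions `Φ` in `B^r` with Lipschitz constant at
most `1`. -/
def dualValues (r : ℝ) (ρ σ : State d q) : Set ℝ :=
  {t : ℝ | ∃ Φ ∈ interactionSpace d q r, Φ.lipschitzConst ≤ 1 ∧
    t = (ρ.expect Φ.specificEnergy).re - (σ.expect Φ.specificEnergy).re}

/-- The sum of the sites of a region moves by `|Λ| • x` under translation by `x`, which determines
`x`. An interaction can thus be prescribed on the translates of `Λ` without conflict. -/
lemma translate_left_injective {Λ : Finset (Site d)} (hΛ : Λ.Nonempty) {x y : Site d}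
    (h : translate x Λ = translate y Λ) : x = y := by
  have hs : ∀ x, ∑ z ∈ translate x Λ, z = ∑ z ∈ Λ, z + Λ.card • x := by
    intro x
    rw [translate, Finset.sum_map]
    simp [Finset.sum_add_distrib]
  have h' := hs y
  rw [← h, hs x] at h'
  funext i
  have := congrFun (add_left_cancel h') i
  simpa [hΛ.card_ne_zero] using this

lemma card_translate (x : Site d) (Λ : Finset (Site d)) : (translate x Λ).card = Λ.card :=
  Finset.card_map _

lemma exists_interaction {Λ : Finset (Site d)} (hΛ : Λ.Nonempty) {H : Op Λ q}
    (hH : H.IsHermitian) : ∃ Φ : Interaction d q,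
      (∀ x, emb _ (Φ.term (translate x Λ)) = translation x (emb Λ H)) ∧
      ∀ X, (∀ x, X ≠ translate x Λ) → Φ.term X = 0 := by
  have : ∀ X : Finset (Site d), ∃ A : Op X q, A.IsHermitian ∧
      (∀ x, X = translate x Λ → emb X A = translation x (emb Λ H)) ∧
      ((∀ x, X ≠ translate x Λ) → A = 0) := by
    intro X
    by_cases h : ∃ x, X = translate x Λ
    · obtain ⟨x, rfl⟩ := h
      refine ⟨opTranslate x Λ H, ?_, fun y hy => ?_, fun h => absurd rfl (h x)⟩
      · exact (IsSelfAdjoint.map (show IsSelfAdjoint H from hH) (opTranslate x Λ) :)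
      · obtain rfl := translate_left_injective hΛ hy
        exact (translation_emb x Λ H).symm
    · exact ⟨0, Matrix.isHermitian_zero, fun x hx => absurd ⟨x, hx⟩ h, fun _ => rfl⟩
  choose A h1 h2 h3 using this
  exact ⟨⟨A, h1⟩, fun x => h2 _ x rfl, h3⟩

/-- The translates of `Λ` that contain `0` are exactly `Λ - x` for `x ∈ Λ`, all distinct, so every
series over regions containing `0` becomes a finite sum. -/
lemma hasSum_translates {M : Type*} [AddCommMonoid M] [TopologicalSpace M] {Λ : Finset (Site d)}
    (hΛ : Λ.Nonempty) (f : Finset (Site d) → M) (hf : ∀ X, (∀ x, X ≠ translate x Λ) → f X = 0) :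
    HasSum (fun X : {X : Finset (Site d) // 0 ∈ X} => f X.1)
      (∑ x : Λ, f (translate (-(x : Site d)) Λ)) := by
  let g : Λ → {X : Finset (Site d) // 0 ∈ X} := fun x =>
    ⟨translate (-(x : Site d)) Λ, by rw [mem_translate, zero_sub, neg_neg]; exact x.2⟩
  have hg : Function.Injective g := fun x y hxy =>
    Subtype.ext (neg_injective (translate_left_injective hΛ (congrArg (·.1) hxy)))
  refine (hg.hasSum_iff ?_).mp (hasSum_fintype _)
  intro X hX
  refine hf _ fun x hx => hX ?_
  have h0 := X.2
  rw [hx, mem_translate, zero_sub] at h0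
  exact ⟨⟨-x, h0⟩, Subtype.ext (by simp [g, hx])⟩

lemma isTranslationInvariant_of_translates {Λ : Finset (Site d)} {a : QuasiLocal d q}
    (hΛ : ∃ H : Op Λ q, a = emb Λ H) {Φ : Interaction d q}
    (h1 : ∀ x, emb _ (Φ.term (translate x Λ)) = translation x a)
    (h2 : ∀ X, (∀ x, X ≠ translate x Λ) → Φ.term X = 0) : Φ.IsTranslationInvariant := by
  obtain ⟨H, rfl⟩ := hΛ
  intro y X
  by_cases h : ∃ x, X = translate x Λ
  · obtain ⟨x, rfl⟩ := h
    rw [h1, translation_translation_emb, translate_translate, h1]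
  · push Not at h
    rw [h2 X h, h2 _ fun z hz => h (z + -y) ?_, map_zero, map_zero, map_zero]
    rw [← translate_translate, ← hz, translate_translate, add_neg_cancel, translate_zero]

lemma expectDiff_ofReal_smul (ρ σ : State d q) (r : ℝ) (a : QuasiLocal d q) :
    expectDiff ρ σ ((r : ℂ) • a) = r * expectDiff ρ σ a := by
  simp [expectDiff_apply, mul_sub]

/-- The `W₁` norm per site of a finite region is attained by an interaction in `B^r` with
Lipschitz constant at most `1`. -/
theorem w1Norm_div_card_mem_dualValues (r : ℝ) {ρ σ : State d q} (hρ : ρ.IsTranslationInvariant)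
    (hσ : σ.IsTranslationInvariant) {Λ : Finset (Site d)} (hΛ : Λ.Nonempty) :
    w1Norm (ρ.marginal Λ - σ.marginal Λ) / Λ.card ∈ dualValues r ρ σ := by
  obtain ⟨H, hH, hHΔ, hHA⟩ :=
    exists_observable_eq_w1Norm (exists_isW1Decomposition_marginal ρ σ Λ)
  choose A hA hoff hdist using hHA
  have hcard : (Λ.card : ℝ) ≠ 0 := by exact_mod_cast hΛ.card_ne_zero
  let c : ℝ := (Λ.card : ℝ)⁻¹
  have hc0 : 0 ≤ c := by positivity
  have hcc : star (c : ℂ) = c := Complex.conj_ofReal c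
  have hcH : ((c : ℂ) • H).IsHermitian := by
    rw [Matrix.IsHermitian, Matrix.conjTranspose_smul, hcc, hH.eq]
  obtain ⟨Φ, h1, h2⟩ := exists_interaction hΛ hcH
  have hinv := isTranslationInvariant_of_translates ⟨_, rfl⟩ h1 h2
  have hsum := hasSum_translates hΛ (fun X => emb X (Φ.term X))
    fun X hX => by rw [h2 X hX, map_zero]
  have hE := hasSum_translates hΛ (fun X => (X.card : ℂ)⁻¹ • emb X (Φ.term X))
    fun X hX => by rw [h2 X hX, map_zero, smul_zero]
  have hS := hasSum_translates hΛ (fun X => Real.exp (r * ((X.card : ℝ) - 1)) * ‖Φ.term X‖)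
    fun X hX => by rw [h2 X hX, norm_zero, mul_zero]
  refine ⟨Φ, ⟨hinv, hS.summable⟩, ?_, ?_⟩
  · rw [Interaction.lipschitzConst, hsum.tsum_eq]
    -- The average of the translated optimal approximants: `A x` does not act on `x`, so its
    -- translate by `-x` does not act on `0`.
    let B : QuasiLocal d q :=
      ∑ x : Λ, translation (-(x : Site d)) (emb Λ ((c : ℂ) • A x))
    have hB : B ∈ observables (q := q) ({0}ᶜ : Set (Site d)) := by
      refine ⟨subset_closure (sum_mem_localIn _ fun x _ => ?_), ?_⟩
      · rw [map_smul]
        refine translation_mem_localIn (-(x : Site d)) (smul_mem_localIn _ (hoff x).emb_mem_localIn)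
          fun y hy h => hy ?_
        exact add_neg_eq_zero.mp h
      · refine isSelfAdjoint_sum _ fun x _ => ?_
        refine IsSelfAdjoint.map (IsSelfAdjoint.map ?_ _) _
        change ((c : ℂ) • A x).IsHermitian
        rw [Matrix.IsHermitian, Matrix.conjTranspose_smul, hcc, (hA x).eq]
    have hle : ‖∑ x : Λ, emb _ (Φ.term (translate (-(x : Site d)) Λ)) - B‖ ≤ 1 / 2 := by
      rw [← Finset.sum_sub_distrib]
      refine (norm_sum_le_of_le (f := fun x : Λ => _) _ (n := fun _ => c * (1 / 2))
        fun x _ => ?_).trans_eq ?_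
      · rw [h1, ← map_sub, norm_translation, ← map_sub, norm_emb, ← smul_sub, norm_smul,
          Complex.norm_real, Real.norm_of_nonneg hc0]
        exact mul_le_mul_of_nonneg_left (hdist x) hc0
      · rw [Finset.sum_const, Finset.card_univ, Fintype.card_coe, nsmul_eq_mul]
        simp only [c]
        field_simp
    have hinf := ciInf_le (f := fun A : observables (q := q) ({0}ᶜ : Set (Site d)) =>
      ‖∑ x : Λ, emb _ (Φ.term (translate (-(x : Site d)) Λ)) - A‖)
      ⟨0, by rintro _ ⟨A, rfl⟩; exact norm_nonneg _⟩ ⟨B, hB⟩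
    rw [dependence]
    linarith [hinf.trans hle]
  · rw [← expectDiff_apply, Interaction.specificEnergy, hE.tsum_eq, map_sum]
    -- One factor `c` comes from the weight `1 / |X|` in the specific energy, the other from the
    -- normalisation of the term; summing over the `|Λ|` translates removes one of them.
    have hx : ∀ x : Λ, expectDiff ρ σ (((translate (-(x : Site d)) Λ).card : ℂ)⁻¹ •
        emb _ (Φ.term (translate (-(x : Site d)) Λ))) =
        c * (c * w1Norm (ρ.marginal Λ - σ.marginal Λ)) := by
      intro x
      rw [card_translate, h1, map_smul (emb Λ), show (Λ.card : ℂ)⁻¹ = (c : ℂ) by simp [c],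
        expectDiff_ofReal_smul, expectDiff_translation hρ hσ, expectDiff_ofReal_smul,
        expectDiff_emb, hHΔ]
    rw [Finset.sum_congr rfl fun x _ => hx x, Finset.sum_const, Finset.card_univ,
      Fintype.card_coe, nsmul_eq_mul]
    simp only [c]
    field_simp

end LocalInteraction

/-! ## Energies with a slowly varying cutoff -/

section Cutoff

lemma real_smul_eq (r : ℝ) (a : QuasiLocal d q) : r • a = (r : ℂ) • a :=
  (Complex.coe_smul r a).symm

lemma translation_real_smul (x : Site d) (r : ℝ) (a : QuasiLocal d q) :
    translation x (r • a) = r • translation x a := by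
  rw [real_smul_eq, map_smul, real_smul_eq]

lemma real_smul_mem_localIn {Γ : Set (Site d)} {a : QuasiLocal d q} (r : ℝ)
    (ha : a ∈ localIn Γ) : r • a ∈ localIn Γ := by
  rw [real_smul_eq]
  exact smul_mem_localIn _ ha

lemma translate_right_injective (x : Site d) : Function.Injective (translate (d := d) x) :=
  Finset.map_injective _

/-- The finite regions of diameter at most `R` that contain the site `x`. -/
def smallRegions (R : ℝ) (x : Site d) : Set (Finset (Site d)) :=
  {X | x ∈ X ∧ ∀ y ∈ X, ∀ z ∈ X, dist y z ≤ R}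

lemma finite_smallRegions (R : ℝ) (x : Site d) : (smallRegions R x).Finite := by
  have h : (Metric.closedBall x R).Finite := (isCompact_closedBall x R).finite_of_discrete
  refine (Finset.finite_toSet h.toFinset.powerset).subset fun X hX => ?_
  rw [Finset.mem_coe, Finset.mem_powerset]
  intro y hy
  rw [Set.Finite.mem_toFinset, Metric.mem_closedBall]
  exact hX.2 y hy x hX.1

lemma translate_mem_smallRegions {R : ℝ} {x : Site d} (y : Site d) {X : Finset (Site d)}
    (hX : X ∈ smallRegions R x) : translate y X ∈ smallRegions R (x + y) := by
  refine ⟨add_mem_translate hX.1, fun z hz w hw => ?_⟩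
  have := hX.2 _ (mem_translate.mp hz) _ (mem_translate.mp hw)
  rwa [dist_sub_right] at this

lemma image_translate_smallRegions {R : ℝ} {F : Finset (Finset (Site d))}
    (hF : ∀ X, X ∈ F ↔ X ∈ smallRegions R 0) (x : Site d) (X : Finset (Site d)) :
    X ∈ F.image (translate x) ↔ X ∈ smallRegions R x := by
  rw [Finset.mem_image]
  constructor
  · rintro ⟨Y, hY, rfl⟩
    simpa using translate_mem_smallRegions x ((hF Y).mp hY)
  · intro hX
    refine ⟨translate (-x) X, (hF _).mpr (by simpa using translate_mem_smallRegions (-x) hX), ?_⟩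
    rw [translate_translate, neg_add_cancel, translate_zero]

lemma abs_average_sub_le {X : Finset (Site d)} (f : Site d → ℝ) (x : Site d) (hx : x ∈ X) {κ : ℝ}
    (h : ∀ y ∈ X, |f y - f x| ≤ κ) : |(∑ y ∈ X, f y) * (X.card : ℝ)⁻¹ - f x| ≤ κ := by
  have hc : (0 : ℝ) < X.card := by exact_mod_cast Finset.card_pos.mpr ⟨x, hx⟩
  have e : (∑ y ∈ X, f y) * (X.card : ℝ)⁻¹ - f x = (∑ y ∈ X, (f y - f x)) * (X.card : ℝ)⁻¹ := by
    rw [Finset.sum_sub_distrib, Finset.sum_const, nsmul_eq_mul]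
    field_simp
  rw [e, abs_mul, abs_of_pos (inv_pos.mpr hc), ← div_eq_mul_inv, div_le_iff₀ hc]
  refine (Finset.abs_sum_le_sum_abs _ _).trans ((Finset.sum_le_sum h).trans_eq ?_)
  rw [Finset.sum_const, nsmul_eq_mul, mul_comm]

/-- The interaction term of the region `X`, as an element of the quasi-local algebra. -/
def Interaction.embTerm (Φ : Interaction d q) (X : Finset (Site d)) : QuasiLocal d q :=
  emb X (Φ.term X)

lemma Interaction.isSelfAdjoint_embTerm (Φ : Interaction d q) (X : Finset (Site d)) :
    IsSelfAdjoint (Φ.embTerm X) :=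
  IsSelfAdjoint.map (show IsSelfAdjoint (Φ.term X) from Φ.isHermitian X) (emb X)

/-- The energy of the interaction terms of the family `P` of regions, each term weighted by the
average over its region of the cutoff function `f`. -/
def cutoffEnergy (Φ : Interaction d q) (P : Finset (Finset (Site d))) (f : Site d → ℝ) :
    QuasiLocal d q :=
  ∑ X ∈ P, ((∑ y ∈ X, f y) * (X.card : ℝ)⁻¹) • Φ.embTerm X

variable {Φ : Interaction d q} {R : ℝ} {F : Finset (Finset (Site d))} {Λ : Finset (Site d)}
  {P : Finset (Finset (Site d))} {f : Site d → ℝ}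

/-- The support of `f` keeps a margin `R` inside `Λ`, so no region of diameter at most `R` around a
site of the support is cut by the boundary. -/
lemma filter_mem_eq_image (hF : ∀ X, X ∈ F ↔ X ∈ smallRegions R 0)
    (hP : ∀ X, X ∈ P ↔ X ⊆ Λ ∧ ∀ y ∈ X, ∀ z ∈ X, dist y z ≤ R)
    (hfΛ : ∀ x, f x ≠ 0 → ∀ y, dist y x ≤ R → y ∈ Λ) {x : Site d} (hx : f x ≠ 0) :
    P.filter (x ∈ ·) = F.image (translate x) := by
  ext X
  rw [Finset.mem_filter, image_translate_smallRegions hF, hP]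
  exact ⟨fun h => ⟨h.2, h.1.2⟩, fun h => ⟨⟨fun y hy => hfΛ x hx y (h.2 y hy x h.1), h.2⟩, h.1⟩⟩

/-- Averaging `f` over `X` divides each term equally among its sites. Exchanging the sums leaves, at
each `x`, `f x` times the translate by `x` of the truncated specific energy. -/
lemma expectDiff_cutoffEnergy {ρ σ : State d q} (hρ : ρ.IsTranslationInvariant)
    (hσ : σ.IsTranslationInvariant) (hΦ : Φ.IsTranslationInvariant)
    (hF : ∀ X, X ∈ F ↔ X ∈ smallRegions R 0)
    (hP : ∀ X, X ∈ P ↔ X ⊆ Λ ∧ ∀ y ∈ X, ∀ z ∈ X, dist y z ≤ R)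
    (hfΛ : ∀ x, f x ≠ 0 → ∀ y, dist y x ≤ R → y ∈ Λ) :
    expectDiff ρ σ (cutoffEnergy Φ P f) =
      (∑ x ∈ Λ, f x) * expectDiff ρ σ (∑ X ∈ F, (X.card : ℝ)⁻¹ • Φ.embTerm X) := by
  have h1 : cutoffEnergy Φ P f =
      ∑ x ∈ Λ, ∑ X ∈ P.filter (x ∈ ·), (f x * (X.card : ℝ)⁻¹) • Φ.embTerm X := by
    rw [cutoffEnergy, Finset.sum_congr rfl fun X _ => by rw [Finset.sum_mul, Finset.sum_smul]]
    refine Finset.sum_comm' fun X x => ?_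
    rw [Finset.mem_filter, hP]
    exact ⟨fun h => ⟨⟨h.1, h.2⟩, h.1.1 h.2⟩, fun h => ⟨h.1.1, h.1.2⟩⟩
  rw [h1, map_sum, Finset.sum_mul]
  refine Finset.sum_congr rfl fun x _ => ?_
  by_cases hx : f x = 0
  · simp [hx]
  · rw [filter_mem_eq_image hF hP hfΛ hx, Finset.sum_image (translate_right_injective x).injOn,
      ← expectDiff_translation hρ hσ x (∑ X ∈ F, (X.card : ℝ)⁻¹ • Φ.embTerm X), ← smul_eq_mul, ← map_smul,
      map_sum (translation x), Finset.smul_sum]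
    congr 1
    refine Finset.sum_congr rfl fun X _ => ?_
    rw [translation_real_smul, smul_smul, card_translate]
    congr 1
    exact hΦ x X

/-- Terms with `x ∉ X` do not act on `x` and go into `B'`. For the others the weight differs from `f
x` by at most `κ`; with weight exactly `f x` they form `f x` times the translate of the full sum,
which is within `b` of the translate of `B`. Where `f x = 0` the sum may be incomplete, harmlessly.
-/
lemma exists_norm_cutoffEnergy_sub_le (hΦ : Φ.IsTranslationInvariant)
    (hF : ∀ X, X ∈ F ↔ X ∈ smallRegions R 0)
    (hP : ∀ X, X ∈ P ↔ X ⊆ Λ ∧ ∀ y ∈ X, ∀ z ∈ X, dist y z ≤ R)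
    (hf0 : ∀ x, 0 ≤ f x) (hf1 : ∀ x, f x ≤ 1)
    (hfΛ : ∀ x, f x ≠ 0 → ∀ y, dist y x ≤ R → y ∈ Λ) {κ : ℝ} (hκ : 0 ≤ κ)
    (hfκ : ∀ x y, dist x y ≤ R → |f x - f y| ≤ κ) {b : ℝ} {B : QuasiLocal d q}
    (hB : B ∈ localIn ({0}ᶜ : Set (Site d))) (hb : ‖∑ X ∈ F, Φ.embTerm X - B‖ ≤ b) (x : Site d) :
    ∃ B' ∈ localIn (q := q) ({x}ᶜ : Set (Site d)),
      ‖cutoffEnergy Φ P f - B'‖ ≤ b + κ * ∑ X ∈ F, ‖Φ.embTerm X‖ := by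
  have hT : ∀ X, Φ.embTerm (translate x X) = translation x (Φ.embTerm X) := hΦ x
  refine ⟨∑ X ∈ P.filter (x ∉ ·), ((∑ y ∈ X, f y) * (X.card : ℝ)⁻¹) • Φ.embTerm X +
    f x • translation x B, ?_, ?_⟩
  · refine add_mem_localIn (sum_mem_localIn _ fun X hX => ?_) ?_
    · refine real_smul_mem_localIn _ (emb_mem_localIn (fun y hy hyx => ?_) _)
      obtain rfl : y = x := hyx
      exact (Finset.mem_filter.mp hX).2 hy
    · refine real_smul_mem_localIn _ (translation_mem_localIn x hB fun y hy hyx => hy ?_)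
      simpa using hyx
  have e : cutoffEnergy Φ P f - (∑ X ∈ P.filter (x ∉ ·),
      ((∑ y ∈ X, f y) * (X.card : ℝ)⁻¹) • Φ.embTerm X + f x • translation x B) =
      ∑ X ∈ P.filter (x ∈ ·), ((∑ y ∈ X, f y) * (X.card : ℝ)⁻¹ - f x) • Φ.embTerm X +
        f x • (∑ X ∈ P.filter (x ∈ ·), Φ.embTerm X - translation x B) := by
    rw [cutoffEnergy, ← Finset.sum_filter_add_sum_filter_not P (x ∈ ·)]
    simp only [sub_smul, Finset.sum_sub_distrib, smul_sub, Finset.smul_sum]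
    abel
  rw [e, add_comm b]
  refine (norm_add_le _ _).trans (add_le_add ?_ ?_)
  · calc ‖∑ X ∈ P.filter (x ∈ ·), ((∑ y ∈ X, f y) * (X.card : ℝ)⁻¹ - f x) • Φ.embTerm X‖
        ≤ ∑ X ∈ P.filter (x ∈ ·), κ * ‖Φ.embTerm X‖ := by
          refine norm_sum_le_of_le _ fun X hX => ?_
          rw [Finset.mem_filter, hP] at hX
          rw [norm_smul, Real.norm_eq_abs]
          exact mul_le_mul_of_nonneg_right (abs_average_sub_le f x hX.2
            fun y hy => hfκ y x (hX.1.2 y hy x hX.2)) (norm_nonneg _)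
      _ ≤ ∑ X ∈ F.image (translate x), κ * ‖Φ.embTerm X‖ := by
          refine Finset.sum_le_sum_of_subset_of_nonneg (fun X hX => ?_)
            fun X _ _ => mul_nonneg hκ (norm_nonneg _)
          rw [Finset.mem_filter, hP] at hX
          exact (image_translate_smallRegions hF x X).mpr ⟨hX.2, hX.1.2⟩
      _ = κ * ∑ X ∈ F, ‖Φ.embTerm X‖ := by
          rw [Finset.sum_image (translate_right_injective x).injOn, Finset.mul_sum]
          simp only [hT, norm_translation]
  · have hb0 : 0 ≤ b := (norm_nonneg _).trans hb
    by_cases hx : f x = 0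
    · simpa [hx] using hb0
    · rw [filter_mem_eq_image hF hP hfΛ hx, Finset.sum_image (translate_right_injective x).injOn]
      simp only [hT]
      rw [← map_sum, ← map_sub, norm_smul, norm_translation, Real.norm_of_nonneg (hf0 x)]
      exact (mul_le_mul (hf1 x) hb (norm_nonneg _) zero_le_one).trans_eq (one_mul b)

lemma sum_mul_expectDiff_le {ρ σ : State d q} (hρ : ρ.IsTranslationInvariant)
    (hσ : σ.IsTranslationInvariant) (hΦ : Φ.IsTranslationInvariant)
    (hF : ∀ X, X ∈ F ↔ X ∈ smallRegions R 0)
    (hf0 : ∀ x, 0 ≤ f x) (hf1 : ∀ x, f x ≤ 1)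
    (hfΛ : ∀ x, f x ≠ 0 → ∀ y, dist y x ≤ R → y ∈ Λ) {κ : ℝ} (hκ : 0 ≤ κ)
    (hfκ : ∀ x y, dist x y ≤ R → |f x - f y| ≤ κ) {b : ℝ} (hb0 : 0 < b) {B : QuasiLocal d q}
    (hB : B ∈ localIn ({0}ᶜ : Set (Site d))) (hb : ‖∑ X ∈ F, Φ.embTerm X - B‖ ≤ b) :
    (∑ x ∈ Λ, f x) * expectDiff ρ σ (∑ X ∈ F, (X.card : ℝ)⁻¹ • Φ.embTerm X) ≤
      2 * (b + κ * ∑ X ∈ F, ‖Φ.embTerm X‖) * w1Norm (ρ.marginal Λ - σ.marginal Λ) := by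
  classical
  let P := Λ.powerset.filter fun X => ∀ y ∈ X, ∀ z ∈ X, dist y z ≤ R
  have hP : ∀ X, X ∈ P ↔ X ⊆ Λ ∧ ∀ y ∈ X, ∀ z ∈ X, dist y z ≤ R := fun X => by
    rw [Finset.mem_filter, Finset.mem_powerset]
  rw [← expectDiff_cutoffEnergy hρ hσ hΦ hF hP hfΛ]
  have hK : cutoffEnergy Φ P f ∈ localIn (q := q) (Λ : Set (Site d)) :=
    sum_mem_localIn _ fun X hX => real_smul_mem_localIn _
      (emb_mem_localIn (Finset.coe_subset.mpr ((hP X).mp hX).1) _)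
  obtain ⟨H, hH⟩ := exists_emb_eq_of_mem_localIn hK
  rw [← hH, expectDiff_emb]
  refine re_trace_mul_le_w1Norm (exists_isW1Decomposition_marginal ρ σ Λ) ?_ fun x => ?_
  · exact add_pos_of_pos_of_nonneg hb0
      (mul_nonneg hκ (Finset.sum_nonneg fun X _ => norm_nonneg _))
  · obtain ⟨_, ⟨X, A, hX, rfl⟩, hA⟩ :=
      exists_norm_cutoffEnergy_sub_le hΦ hF hP hf0 hf1 hfΛ hκ hfκ hB hb (x : Site d)
    rw [← hH] at hA
    exact ⟨X, A, fun hx => hX hx rfl, hA⟩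

end Cutoff

/-! ## Boxes -/

section Box

/-- The box `{x : -a + m ≤ x < a - m}`. -/
def innerBox (m : ℕ) (a : Fin d → ℕ+) : Finset (Site d) :=
  Fintype.piFinset fun i => Finset.Ico (-((a i : ℕ) : ℤ) + m) (((a i : ℕ) : ℤ) - m)

lemma mem_innerBox {m : ℕ} {a : Fin d → ℕ+} {x : Site d} :
    x ∈ innerBox m a ↔ ∀ i, -((a i : ℕ) : ℤ) + m ≤ x i ∧ x i < ((a i : ℕ) : ℤ) - m := by
  simp [innerBox]

lemma mem_box {a : Fin d → ℕ+} {x : Site d} :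
    x ∈ box a ↔ ∀ i, -((a i : ℕ) : ℤ) ≤ x i ∧ x i < ((a i : ℕ) : ℤ) := by
  simp [box]

lemma mem_box_of_dist_lt {m : ℕ} {a : Fin d → ℕ+} {x y : Site d} (hy : y ∈ innerBox m a)
    (h : dist x y < m) : x ∈ box a := by
  rw [mem_innerBox] at hy
  refine mem_box.mpr fun i => ?_
  have h1 := (dist_le_pi_dist x y i).trans_lt h
  rw [Int.dist_eq, ← Int.cast_sub, ← Int.cast_abs] at h1
  have h2 : |x i - y i| < (m : ℤ) := by exact_mod_cast h1
  rw [abs_lt] at h2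
  have := hy i
  omega

lemma nonempty_box (a : Fin d → ℕ+) : (box a).Nonempty :=
  ⟨0, mem_box.mpr fun i => by have := (a i).pos; simp⟩

lemma tendsto_card_innerBox_div (d m : ℕ) :
    Tendsto (fun a : Fin d → ℕ+ => ((innerBox m a).card : ℝ) / (box a).card) atTop (𝓝 1) := by
  have hi : ∀ i : Fin d, Tendsto (fun a : Fin d → ℕ+ => ((a i : ℕ) : ℝ)) atTop atTop := by
    intro i
    refine tendsto_natCast_atTop_atTop.comp (tendsto_atTop.mpr fun n => ?_)
    filter_upwards [eventually_ge_atTop (fun _ => ⟨n + 1, n.succ_pos⟩ : Fin d → ℕ+)] with a ha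
    have : n + 1 ≤ (a i : ℕ) := ha i
    omega
  have h1 : Tendsto (fun a : Fin d → ℕ+ => ∏ i, (1 - (m : ℝ) / (a i : ℕ))) atTop (𝓝 1) := by
    have := tendsto_finsetProd (Finset.univ : Finset (Fin d))
      (f := fun i (a : Fin d → ℕ+) => 1 - (m : ℝ) / (a i : ℕ)) (x := atTop) (a := fun _ => 1)
      fun i _ => by simpa using (tendsto_const_nhds (x := (m : ℝ))).div_atTop (hi i) |>.const_sub 1
    simpa using this
  refine h1.congr' ?_
  filter_upwards [eventually_ge_atTop (fun _ => ⟨m + 1, m.succ_pos⟩ : Fin d → ℕ+)] with a ha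
  rw [innerBox, box, Fintype.card_piFinset, Fintype.card_piFinset, Nat.cast_prod, Nat.cast_prod,
    ← Finset.prod_div_distrib]
  refine Finset.prod_congr rfl fun i _ => ?_
  have h : m + 1 ≤ (a i : ℕ) := ha i
  rw [Int.card_Ico, Int.card_Ico,
    show (((a i : ℕ) : ℤ) - m - (-((a i : ℕ) : ℤ) + m)).toNat = 2 * ((a i : ℕ) - m) by omega,
    show (((a i : ℕ) : ℤ) - -((a i : ℕ) : ℤ)).toNat = 2 * (a i : ℕ) by omega,
    Nat.cast_mul, Nat.cast_mul, Nat.cast_sub (by omega)]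
  have : ((a i : ℕ) : ℝ) ≠ 0 := by exact_mod_cast (a i).ne_zero
  push_cast
  field_simp

/-- A cutoff function that is supported well inside of the box, is equal to `1` in most of the
box, and varies slowly. -/
lemma exists_cutoff (R N : ℕ) (hN : 0 < N) (a : Fin d → ℕ+)
    (hne : (innerBox (N + R) a).Nonempty) : ∃ f : Site d → ℝ, (∀ x, 0 ≤ f x) ∧ (∀ x, f x ≤ 1) ∧
      (∀ x, f x ≠ 0 → ∀ y, dist y x ≤ (R : ℝ) → y ∈ box a) ∧
      (∀ x y, dist x y ≤ (R : ℝ) → |f x - f y| ≤ (R : ℝ) / N) ∧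
      ((innerBox (N + R) a).card : ℝ) ≤ ∑ x ∈ box a, f x := by
  let S : Set (Site d) := innerBox (N + R) a
  have hN' : (0 : ℝ) < N := by exact_mod_cast hN
  have hmax : ∀ x, 0 ≤ max (1 - Metric.infDist x S / N) 0 := fun x => le_max_right _ _
  -- The slope `1 / N` makes `f` vanish at distance `N` from the inner box; the remaining `R` of the
  -- margin `N + R` holds the regions that meet the support.
  refine ⟨fun x => max (1 - Metric.infDist x S / N) 0, hmax, ?_, ?_, ?_, ?_⟩
  · intro x
    have : 0 ≤ Metric.infDist x S / N := div_nonneg Metric.infDist_nonneg hN'.le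
    exact max_le (by linarith) zero_le_one
  · intro x hx y hy
    have h1 : Metric.infDist x S < N := by
      by_contra! h
      refine hx (max_eq_right ?_)
      rw [sub_nonpos, le_div_iff₀ hN', one_mul]
      exact h
    obtain ⟨z, hz, hxz⟩ := (Metric.infDist_lt_iff hne).mp h1
    refine mem_box_of_dist_lt hz ?_
    push_cast
    linarith [dist_triangle y x z]
  · intro x y hxy
    refine (abs_max_sub_max_le_abs _ _ _).trans ?_
    have h1 := (Metric.lipschitz_infDist_pt S).dist_le_mul x y
    rw [Real.dist_eq, NNReal.coe_one, one_mul] at h1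
    have h2 : 1 - Metric.infDist x S / N - (1 - Metric.infDist y S / N) =
        -((Metric.infDist x S - Metric.infDist y S) / N) := by ring
    rw [h2, abs_neg, abs_div, abs_of_pos hN']
    exact div_le_div_of_nonneg_right (h1.trans hxy) hN'.le
  · have h1 : innerBox (N + R) a ⊆ box a := fun x hx => by
      refine mem_box_of_dist_lt hx ?_
      rw [dist_self]
      exact_mod_cast Nat.add_pos_left hN R
    calc ((innerBox (N + R) a).card : ℝ)
        = ∑ x ∈ innerBox (N + R) a, max (1 - Metric.infDist x S / N) 0 := by
          rw [Finset.sum_congr rfl (g := fun _ => (1 : ℝ)), Finset.sum_const, nsmul_eq_mul, mul_one]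
          intro x hx
          rw [Metric.infDist_zero_of_mem (s := S) hx]
          simp
      _ ≤ _ := Finset.sum_le_sum_of_subset_of_nonneg h1 fun x _ _ => hmax x

end Box

/-! ## The specific quantum `W₁` distance -/

section Specific

lemma w1PerSite_nonneg (ρ σ : State d q) (a : Fin d → ℕ+) : 0 ≤ w1PerSite ρ σ a :=
  div_nonneg (w1Norm_nonneg _) (Nat.cast_nonneg _)

lemma w1PerSite_le_two (ρ σ : State d q) (a : Fin d → ℕ+) : w1PerSite ρ σ a ≤ 2 := by
  have h := w1Norm_sub_le (ρ.posSemidef_marginal (box a)) (σ.posSemidef_marginal (box a))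
    (ρ.trace_marginal _) (σ.trace_marginal _)
  rw [Fintype.card_coe] at h
  have hc : (0 : ℝ) < (box a).card := by exact_mod_cast (nonempty_box a).card_pos
  rw [w1PerSite, div_le_iff₀ hc]
  exact h

lemma zero_mem_observables (Γ : Set (Site d)) : 0 ∈ observables (q := q) Γ :=
  ⟨subset_closure ⟨∅, 0, by simp, by simp⟩, IsSelfAdjoint.zero _⟩

/-- The only use of `r > 0` and of the exponential weight, which is at least `1` on regions
containing `0`. -/
lemma summable_norm_embTerm {r : ℝ} (hr : 0 < r) {Φ : Interaction d q}
    (hΦ : Φ ∈ interactionSpace d q r) :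
    Summable fun X : {X : Finset (Site d) // 0 ∈ X} => ‖Φ.embTerm X.1‖ := by
  refine Summable.of_nonneg_of_le (fun _ => norm_nonneg _) (fun X => ?_) hΦ.2
  rw [Interaction.embTerm, norm_emb]
  have h1 : (1 : ℝ) ≤ X.1.card := by exact_mod_cast Finset.card_pos.mpr ⟨0, X.2⟩
  exact le_mul_of_one_le_left (norm_nonneg _)
    (Real.one_le_exp (mul_nonneg hr.le (sub_nonneg.mpr h1)))

lemma exists_smallRegions_subset (s : Finset {X : Finset (Site d) // 0 ∈ X}) :
    ∃ R : ℕ, ∀ X ∈ s, X.1 ∈ smallRegions (R : ℝ) (0 : Site d) := by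
  classical
  have hb : Bornology.IsBounded ((s.biUnion (·.1) : Finset (Site d)) : Set (Site d)) :=
    (Finset.finite_toSet _).isBounded
  obtain ⟨C, hC⟩ := Metric.isBounded_iff.mp hb
  obtain ⟨R, hR⟩ := exists_nat_ge C
  refine ⟨R, fun X hX => ⟨X.2, fun y hy z hz => (hC ?_ ?_).trans hR⟩⟩
  · exact Finset.mem_coe.mpr (Finset.mem_biUnion.mpr ⟨X, hX, hy⟩)
  · exact Finset.mem_coe.mpr (Finset.mem_biUnion.mpr ⟨X, hX, hz⟩)

/-- The partial sums over the regions of bounded diameter approximate a convergent sum. -/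
lemma exists_smallRegions_norm_sub_lt {g h : Finset (Site d) → QuasiLocal d q}
    (hg : Summable fun X : {X : Finset (Site d) // 0 ∈ X} => g X.1)
    (hh : Summable fun X : {X : Finset (Site d) // 0 ∈ X} => h X.1) {δ : ℝ} (hδ : 0 < δ) :
    ∃ (R : ℕ) (F : Finset (Finset (Site d))), (∀ X, X ∈ F ↔ X ∈ smallRegions (R : ℝ) 0) ∧
      ‖∑' X : {X : Finset (Site d) // 0 ∈ X}, g X.1 - ∑ X ∈ F, g X‖ < δ ∧
      ‖∑' X : {X : Finset (Site d) // 0 ∈ X}, h X.1 - ∑ X ∈ F, h X‖ < δ := by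
  classical
  obtain ⟨s, hs⟩ := eventually_atTop.mp
    ((hg.hasSum.eventually (Metric.ball_mem_nhds _ hδ)).and
      (hh.hasSum.eventually (Metric.ball_mem_nhds _ hδ)))
  obtain ⟨R, hR⟩ := exists_smallRegions_subset s
  let F := (finite_smallRegions (R : ℝ) (0 : Site d)).toFinset
  have hF : ∀ X, X ∈ F ↔ X ∈ smallRegions (R : ℝ) (0 : Site d) := fun X =>
    Set.Finite.mem_toFinset _
  have hsF : s ≤ F.subtype (0 ∈ ·) := fun X hX =>
    Finset.mem_subtype.mpr ((hF _).mpr (hR X hX))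
  have hF0 : ∀ X ∈ F, (0 : Site d) ∈ X := fun X hX => ((hF X).mp hX).1
  obtain ⟨h1, h2⟩ := hs _ hsF
  rw [dist_comm, dist_eq_norm] at h1 h2
  rw [Finset.sum_subtype_of_mem g hF0] at h1
  rw [Finset.sum_subtype_of_mem h hF0] at h2
  exact ⟨R, F, hF, h1, h2⟩

/-- Half of `δ` pays for a near-minimiser, half for its local approximation. `B` need not be
self-adjoint; `re_trace_mul_le` accepts any operator as first factor. -/
lemma exists_localIn_norm_sub_lt {x : Site d} {h : QuasiLocal d q} (hd : dependence x h ≤ 1)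
    {δ : ℝ} (hδ : 0 < δ) :
    ∃ B ∈ localIn (q := q) ({x}ᶜ : Set (Site d)), ‖h - B‖ < 1 / 2 + δ := by
  have : Nonempty (observables (q := q) ({x}ᶜ : Set (Site d))) := ⟨⟨0, zero_mem_observables _⟩⟩
  obtain ⟨⟨A, hA⟩, hAh⟩ := exists_lt_of_ciInf_lt
    (f := fun A : observables (q := q) ({x}ᶜ : Set (Site d)) => ‖h - A‖) (a := 1 / 2 + δ / 2)
    (by rw [dependence] at hd; linarith)
  obtain ⟨B, hB, hAB⟩ := Metric.mem_closure_iff.mp hA.1 (δ / 2) (half_pos hδ)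
  rw [dist_eq_norm] at hAB
  refine ⟨B, hB, ?_⟩
  have := norm_sub_le_norm_sub_add_norm_sub h A B
  linarith

lemma Interaction.specificEnergy_eq (Φ : Interaction d q) : Φ.specificEnergy =
    ∑' X : {X : Finset (Site d) // 0 ∈ X}, (X.1.card : ℝ)⁻¹ • Φ.embTerm X.1 := by
  refine tsum_congr fun X => ?_
  rw [real_smul_eq]
  push_cast
  rfl

/-- The difference of the expectation values of the specific energies is asymptotically a lower
bound for the `W₁` distance per site. -/
theorem eventually_sub_le_w1PerSite {r : ℝ} (hr : 0 < r) {ρ σ : State d q}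
    (hρ : ρ.IsTranslationInvariant) (hσ : σ.IsTranslationInvariant) {t : ℝ}
    (ht : t ∈ dualValues r ρ σ) {η : ℝ} (hη : 0 < η) :
    ∀ᶠ a in atTop, t - η ≤ w1PerSite ρ σ a := by
  obtain ⟨Φ, hΦ, hL, rfl⟩ := ht
  rw [← expectDiff_apply]
  have hs := summable_norm_embTerm hr hΦ
  have hsE : Summable fun X : {X : Finset (Site d) // 0 ∈ X} =>
      (X.1.card : ℝ)⁻¹ • Φ.embTerm X.1 := by
    refine Summable.of_norm (Summable.of_nonneg_of_le (fun _ => norm_nonneg _) (fun X => ?_) hs)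
    rw [norm_smul, norm_inv, Real.norm_natCast]
    exact mul_le_of_le_one_left (norm_nonneg _) (Nat.cast_inv_le_one _)
  -- The losses are `2δ` from truncating the energy, `δ` from the boundary layer and `12δ` from the
  -- excess Lipschitz constant, `15δ` in all.
  let δ := η / 19
  have hδ : 0 < δ := by positivity
  obtain ⟨R, F, hF, hh, hE⟩ := exists_smallRegions_norm_sub_lt
    (g := Φ.embTerm) (h := fun X => (X.card : ℝ)⁻¹ • Φ.embTerm X) hs.of_norm hsE hδ
  rw [← Φ.specificEnergy_eq] at hE
  obtain ⟨B, hB, hBh⟩ := exists_localIn_norm_sub_lt hL hδ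
  have hb : ‖∑ X ∈ F, Φ.embTerm X - B‖ ≤ 1 / 2 + 2 * δ := by
    have := norm_sub_le_norm_sub_add_norm_sub (∑ X ∈ F, Φ.embTerm X)
      (∑' X : {X : Finset (Site d) // 0 ∈ X}, Φ.embTerm X.1) B
    rw [norm_sub_rev] at hh
    change ‖∑' X : {X : Finset (Site d) // 0 ∈ X}, Φ.embTerm X.1 - B‖ < _ at hBh
    linarith
  let t' := expectDiff ρ σ (∑ X ∈ F, (X.card : ℝ)⁻¹ • Φ.embTerm X)
  have ht' : expectDiff ρ σ Φ.specificEnergy - 2 * δ ≤ t' := by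
    have hsa : ∀ X, IsSelfAdjoint ((X.card : ℝ)⁻¹ • Φ.embTerm X) := fun X =>
      (IsSelfAdjoint.all _).smul (Φ.isSelfAdjoint_embTerm X)
    have h1 : IsSelfAdjoint (Φ.specificEnergy - ∑ X ∈ F, (X.card : ℝ)⁻¹ • Φ.embTerm X) := by
      refine IsSelfAdjoint.sub ?_ (isSelfAdjoint_sum _ fun X _ => hsa X)
      rw [Φ.specificEnergy_eq, IsSelfAdjoint, tsum_star]
      exact tsum_congr fun X => hsa X.1
    have h2 := expectDiff_le ρ σ h1
    rw [map_sub] at h2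
    linarith
  let M := ∑ X ∈ F, ‖Φ.embTerm X‖
  have hM : 0 ≤ M := Finset.sum_nonneg fun _ _ => norm_nonneg _
  -- The cutoff varies by at most `R / N` over a region of diameter `R`; this `N` makes the
  -- resulting error `R / N * M` at most `δ`.
  obtain ⟨N, hN⟩ := exists_nat_gt ((R : ℝ) * M / δ)
  have hN0 : (0 : ℝ) < N := lt_of_le_of_lt (by positivity) hN
  have hκ : (R : ℝ) / N * M ≤ δ := by
    rw [div_lt_iff₀ hδ] at hN
    rw [div_mul_eq_mul_div, div_le_iff₀ hN0]
    linarith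
  have hlim := tendsto_card_innerBox_div d (N + R)
  have hlim' : Tendsto (fun a : Fin d → ℕ+ =>
      (1 - ((innerBox (N + R) a).card : ℝ) / (box a).card) * |t'|) atTop (𝓝 0) := by
    simpa using (hlim.const_sub 1).mul_const |t'|
  filter_upwards [hlim'.eventually (ge_mem_nhds hδ), hlim.eventually (lt_mem_nhds one_pos)]
    with a ha ha0
  have hc : (0 : ℝ) < (box a).card := by exact_mod_cast (nonempty_box a).card_pos
  have hne : (innerBox (N + R) a).Nonempty := by
    rw [Finset.nonempty_iff_ne_empty]
    rintro h
    simp [h] at ha0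
  obtain ⟨f, hf0, hf1, hfΛ, hfκ, hfs⟩ := exists_cutoff R N (by exact_mod_cast hN0) a hne
  have key := sum_mul_expectDiff_le hρ hσ hΦ.1 hF hf0 hf1 hfΛ (by positivity) hfκ
    (by positivity) hB hb
  have hsum1 : ∑ x ∈ box a, f x ≤ (box a).card := by
    refine (Finset.sum_le_sum fun x _ => hf1 x).trans_eq ?_
    rw [Finset.sum_const, nsmul_eq_mul, mul_one]
  let s := (∑ x ∈ box a, f x) / (box a).card
  have hs1 : s ≤ 1 := (div_le_one hc).mpr hsum1
  have hs0 : ((innerBox (N + R) a).card : ℝ) / (box a).card ≤ s :=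
    div_le_div_of_nonneg_right hfs hc.le
  have hw : w1Norm (ρ.marginal (box a) - σ.marginal (box a)) =
      w1PerSite ρ σ a * (box a).card := by
    rw [w1PerSite, div_mul_cancel₀ _ hc.ne']
  have hst : s * t' ≤ 2 * (1 / 2 + 2 * δ + (R : ℝ) / N * M) * w1PerSite ρ σ a := by
    rw [hw] at key
    change _ * t' ≤ _ at key
    rw [← mul_le_mul_iff_left₀ hc]
    calc s * t' * (box a).card = (∑ x ∈ box a, f x) * t' := by
          simp only [s]; field_simp
      _ ≤ _ := key
      _ = _ := by ring
  -- The absolute value is needed because `t'` may have either sign.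
  have h1 : t' - δ ≤ s * t' := by
    have h2 : (1 - s) * t' ≤ (1 - s) * |t'| :=
      mul_le_mul_of_nonneg_left (le_abs_self _) (by linarith)
    have h3 : (1 - s) * |t'| ≤ (1 - ((innerBox (N + R) a).card : ℝ) / (box a).card) * |t'| :=
      mul_le_mul_of_nonneg_right (by linarith) (abs_nonneg _)
    linarith
  have h4 : 2 * (1 / 2 + 2 * δ + (R : ℝ) / N * M) * w1PerSite ρ σ a ≤
      w1PerSite ρ σ a + 12 * δ := by
    have h5 := w1PerSite_nonneg ρ σ a
    have h6 := w1PerSite_le_two ρ σ a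
    have h7 : 2 * (1 / 2 + 2 * δ + (R : ℝ) / N * M) * w1PerSite ρ σ a ≤
        (1 + 6 * δ) * w1PerSite ρ σ a := mul_le_mul_of_nonneg_right (by linarith) h5
    have h8 := mul_le_mul_of_nonneg_left h6 hδ.le
    linarith
  have h9 : η = 19 * δ := by simp only [δ]; ring
  linarith

end Specific

end QuantumSpin

end

open QuantumSpin in
theorem mainTheorem3 (d q : ℕ) [NeZero q] (r : ℝ) (hr : 0 < r) (ρ σ : State d q)
    (hρ : ρ.IsTranslationInvariant) (hσ : σ.IsTranslationInvariant) :
    Tendsto (w1PerSite ρ σ) atTop (𝓝 (specificW1 ρ σ)) ∧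
      IsLUB {t : ℝ | ∃ Φ ∈ interactionSpace d q r, Φ.lipschitzConst ≤ 1 ∧
        t = (ρ.expect Φ.specificEnergy).re - (σ.expect Φ.specificEnergy).re}
        (specificW1 ρ σ) := by
  change _ ∧ IsLUB (dualValues r ρ σ) _
  have hmem : ∀ a, w1PerSite ρ σ a ∈ dualValues r ρ σ := fun a =>
    w1Norm_div_card_mem_dualValues r hρ hσ (nonempty_box a)
  have hbdd : BddAbove (dualValues r ρ σ) := by
    -- `3 = 2 + 1`: the distance per site is at most `2`, and a dual value exceeds it by at most `η
    -- = 1` in some box.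
    refine ⟨3, fun t ht => ?_⟩
    obtain ⟨a, ha⟩ := (eventually_sub_le_w1PerSite hr hρ hσ ht one_pos).exists
    linarith [w1PerSite_le_two ρ σ a]
  have hlub : IsLUB (dualValues r ρ σ) (sSup (dualValues r ρ σ)) :=
    isLUB_csSup ⟨_, hmem 1⟩ hbdd
  have hlim : Tendsto (w1PerSite ρ σ) atTop (𝓝 (sSup (dualValues r ρ σ))) := by
    -- The upper estimate holds in every box by membership; only the lower one is asymptotic.
    refine tendsto_order.mpr ⟨fun b hb => ?_, fun b hb =>
      Eventually.of_forall fun a => (hlub.1 (hmem a)).trans_lt hb⟩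
    obtain ⟨t, ht, hbt⟩ := (lt_isLUB_iff hlub).mp hb
    filter_upwards [eventually_sub_le_w1PerSite hr hρ hσ ht (half_pos (sub_pos.mpr hbt))] with a ha
    linarith
  have he : specificW1 ρ σ = sSup (dualValues r ρ σ) := hlim.limUnder_eq
  rw [he]
  exact ⟨hlim, hlub⟩
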